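/- Let $n,d\ge 1$ and $\mathcal A=\mathbb Z[v,v^{-1}]$. For a finite field $\mathbb F_q$ of odd characteristic let $\mathscr X$ be the set of flags $0=V_0\subseteq V_1\subseteq\dots\subseteq V_n=\mathbb F_q^d$. To a pair $(V,V')\in\mathscr X\times\mathscr X$ attach the $n\times n$ matrix with $(i,j)$ entry $\dim\frac{V_{i-1}+V_i\cap V'_j}{V_{i-1}+V_i\cap V'_{j-1}}$; this identifies the $GL(\mathbb F_q^d)$-orbits on $\mathscr X\times\mathscr X$ with the set $\Theta_d$ of $n\times n$ matrices over $\mathbb N$ whose entries sum to $d$. Let $\mathcal S$ be the associative $\mathcal A$-algebra, free as an $\mathcal A$-module with basis $e_A$ $(A\in\Theta_d)$, whose product becomes, for every such $q$, under $v\mapsto\sqrt q$ and with $e_A$ sent to the characteristic function of the orbit of $A$, the convolution $(f*g)(V,V')=\sum_{V''\in\mathscr X}f(V,V'')g(V'',V')$. For $A=(a_{ij})$, $B=(b_{ij})$ in $\Theta_d$ write $A\preceq B$ if $$\sum_{r\le i,\,s\ge j}a_{rs}\le\sum_{r\le i,\,s\ge j}b_{rs}\ \ (i<j),\qquad \sum_{r\ge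 i,\,s\le j}a_{rs}\le\sum_{r\ge i,\,s\le j}b_{rs}\ \ (i>j),$$ and $A\prec B$ if $A\preceq B$ and not $B\preceq A$. Let $E_{ij}$ denote the matrix units. **Theorem.** For every $A=(a_{ij})\in\Theta_d$ there is exactly one family $(D_{ij})_{1\le i\ne j\le n}$ of diagonal matrices with entries in $\mathbb N$ such that $D_{ij}+a_{ij}E_{ij}\in\Theta_d$ for all $i\neq j$ and $$\prod_{1\le j<i\le n}e_{D_{ij}+a_{ij}E_{ij}}*\prod_{1\le i<j\le n}e_{D_{ij}+a_{ij}E_{ij}}=\chi_A e_A+\text{lower terms}$$ in $\mathcal S$ for some $\chi_A\in\mathcal A\setminus\{0\}$, where "lower terms" means an $\mathcal A$-linear combination of elements $e_C$ with $C\in\Theta_d$, $C\prec A$. In the first product the factor of $(i,j)$ stands before (to the left of) that of $(i',j')$ if $j<j'$, or $j=j'$ and $i<i'$; in the second product the factor of $(i,j)$ stands before that of $(i',j')$ if $j>j'$, or $j=j'$ and $i>i'$. -/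

import Mathlib

open scoped LaurentPolynomial

noncomputable section

namespace BLM

/-- The ground ring `𝒜 = ℤ[v, v⁻¹]`. -/
abbrev LaurentA : Type := ℤ[T;T⁻¹]

/-- `n`-step flags `0 = V₀ ⊆ V₁ ⊆ ⋯ ⊆ Vₙ = K^d`. -/
@[ext]
structure Flag (K : Type) [Field K] (n d : ℕ) where
  space : Fin (n + 1) → Submodule K (Fin d → K)
  mono : Monotone space
  first : space 0 = ⊥
  last : space (Fin.last n) = ⊤

instance instFiniteFlag (K : Type) [Field K] [Finite K] (n d : ℕ) : Finite (Flag K n d) := by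
  have : Finite (Submodule K (Fin d → K)) := Finite.of_injective _ SetLike.coe_injective
  exact Finite.of_injective (fun V : Flag K n d => V.space) (fun _ _ h => Flag.ext h)

instance instFintypeFlag (K : Type) [Field K] [Finite K] (n d : ℕ) : Fintype (Flag K n d) :=
  Fintype.ofFinite _

instance instDecidableEqFlag (K : Type) [Field K] (n d : ℕ) : DecidableEq (Flag K n d) :=
  Classical.decEq _

/-- The matrix of a pair of flags: its `(i, j)` entry (`1 ≤ i, j ≤ n`, shifted to `Fin n`) is
`dim (V_{i-1} + V_i ∩ V'_j) / (V_{i-1} + V_i ∩ V'_{j-1})`. Two pairs of flags lie in the same orbit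
of `GL_d(K)` exactly when their matrices agree. -/
def relPos {K : Type} [Field K] {n d : ℕ} (V V' : Flag K n d) : Matrix (Fin n) (Fin n) ℕ :=
  fun i j =>
    Module.finrank K
      (↥(V.space i.castSucc ⊔ V.space i.succ ⊓ V'.space j.succ) ⧸
        (V.space i.castSucc ⊔ V.space i.succ ⊓ V'.space j.castSucc).submoduleOf
          (V.space i.castSucc ⊔ V.space i.succ ⊓ V'.space j.succ))

/-- `Θ_d`: the `n × n` matrices over `ℕ` with sum of entries `d`. -/
def Theta (n d : ℕ) : Set (Matrix (Fin n) (Fin n) ℕ) :=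
  {A | ∑ i, ∑ j, A i j = d}

/-- The finite fields of odd characteristic, one field of each order `q = p ^ r`. -/
structure OddField where
  p : ℕ
  r : ℕ
  prime : Fact p.Prime
  odd : Odd p
  pos : r ≠ 0

instance instFactPrime (κ : OddField) : Fact κ.p.Prime := κ.prime

/-- The field with `q = p ^ r` elements. -/
abbrev OddField.K (κ : OddField) : Type := GaloisField κ.p κ.r

/-- The element `√q` of `ℝˣ`. -/
def OddField.sqrtQ (κ : OddField) : ℝˣ :=
  Units.mk0 (Real.sqrt ((κ.p : ℝ) ^ κ.r))
    (Real.sqrt_ne_zero'.mpr (pow_pos (Nat.cast_pos.mpr κ.prime.out.pos) _))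

/-- Specialization `v ↦ √q`. -/
def OddField.spec (κ : OddField) : LaurentA →+* ℝ :=
  LaurentPolynomial.eval₂ (Int.castRingHom ℝ) κ.sqrtQ

/-- Families, indexed by the finite fields of odd characteristic, of real functions on the set of
pairs of flags. For each field the product is the matrix product, that is the convolution
`(f * g)(V, V') = ∑ V'', f (V, V'') * g (V'', V')`. -/
def ConvFamily (n d : ℕ) : Type :=
  (κ : OddField) → Matrix (Flag κ.K n d) (Flag κ.K n d) ℝ

instance instRingConvFamily (n d : ℕ) : Ring (ConvFamily n d) :=
  inferInstanceAs (Ring ((κ : OddField) → Matrix (Flag κ.K n d) (Flag κ.K n d) ℝ))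

/-- A Laurent polynomial, seen as the family of scalars obtained from `v ↦ √q`. -/
def scalarHom (n d : ℕ) : LaurentA →+* ConvFamily n d :=
  RingHom.pi fun κ => (Matrix.scalar (Flag κ.K n d)).comp κ.spec

/-- `v` acts on the component at the field with `q` elements as `√q`. -/
instance instAlgebraConvFamily (n d : ℕ) : Algebra LaurentA (ConvFamily n d) :=
  (scalarHom n d).toAlgebra' fun c x => by
    funext κ
    exact Matrix.scalar_commute (κ.spec c) (fun r => mul_comm _ r) (x κ)

open Classical in
/-- The characteristic function of the orbit with matrix `M`, over all fields at once
(it is zero when `M ∉ Θ_d`). -/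
def orbitFun (n d : ℕ) (M : Matrix (Fin n) (Fin n) ℕ) : ConvFamily n d :=
  fun _ => Matrix.of fun V V' => if relPos V V' = M then 1 else 0

/-- The generic convolution algebra `𝒮` over `𝒜 = ℤ[v, v⁻¹]`. Its product is the one that becomes
the convolution product over the field with `q` elements when `v` is specialized to `√q`, for all
`q`. It is realized inside the product of all these specializations, where it is generated by the
characteristic functions `e_M` of the orbits. -/
def schurAlgebra (n d : ℕ) : Subalgebra LaurentA (ConvFamily n d) :=
  Algebra.adjoin LaurentA (Set.range (orbitFun n d))

/-- The element `e_M` of `𝒮`. -/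
def e (n d : ℕ) (M : Matrix (Fin n) (Fin n) ℕ) : schurAlgebra n d :=
  ⟨orbitFun n d M, Algebra.subset_adjoin (Set.mem_range_self M)⟩

/-- The relation `A ≼ B`. -/
def Preceq {n : ℕ} (A B : Matrix (Fin n) (Fin n) ℕ) : Prop :=
  (∀ i j : Fin n, i < j →
    ∑ r ∈ Finset.Iic i, ∑ s ∈ Finset.Ici j, A r s ≤
      ∑ r ∈ Finset.Iic i, ∑ s ∈ Finset.Ici j, B r s) ∧
  (∀ i j : Fin n, j < i →
    ∑ r ∈ Finset.Ici i, ∑ s ∈ Finset.Iic j, A r s ≤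
      ∑ r ∈ Finset.Ici i, ∑ s ∈ Finset.Iic j, B r s)

/-- The strict relation of `≼`. -/
def Prec {n : ℕ} (A B : Matrix (Fin n) (Fin n) ℕ) : Prop :=
  Preceq A B ∧ ¬ Preceq B A

/-- Off-diagonal positions `(i, j)`. -/
abbrev OffDiag (n : ℕ) : Type := {p : Fin n × Fin n // p.1 ≠ p.2}

/-- The positions `(i, j)` with `j < i`; `(i, j)` comes before `(i', j')` if `j < j'`, or `j = j'`
and `i < i'`. -/
def lowerList (n : ℕ) : List (OffDiag n) :=
  (List.finRange n).flatMap fun j =>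
    (List.finRange n).filterMap fun i =>
      if h : j < i then some ⟨(i, j), h.ne'⟩ else none

/-- The positions `(i, j)` with `i < j`; `(i, j)` comes before `(i', j')` if `j > j'`, or `j = j'`
and `i > i'`. -/
def upperList (n : ℕ) : List (OffDiag n) :=
  (List.finRange n).reverse.flatMap fun j =>
    (List.finRange n).reverse.filterMap fun i =>
      if h : i < j then some ⟨(i, j), h.ne⟩ else none

/-- The matrix `D + a_{ij} E_{ij}`, where `D` is the diagonal matrix with the given entries and
`p = (i, j)`. -/
def elemMatrix {n : ℕ} (A : Matrix (Fin n) (Fin n) ℕ) (D : Fin n → ℕ) (p : OffDiag n) :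
    Matrix (Fin n) (Fin n) ℕ :=
  Matrix.diagonal D + Matrix.single p.1.1 p.1.2 (A p.1.1 p.1.2)

end BLM

end

/-! The value of the product at $(V,V')$ counts the chains of flags from $V$ to $V'$ whose
successive relative positions are the $D_p+a_pE_p$. Nothing cancels, so over a given field the
product is nonzero at $(V,V')$ exactly when such a chain exists (`orbitProd_ne_zero_iff`). What
remains is a study of chains, and the fact that the counts are integer polynomials in $q$.

Triangularity: a factor below the diagonal enlarges the flag, one above it shrinks the flag. The
partial sums defining $\preceq$ are codimensions of intersections $V_k\cap V'_l$. As the factors are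
ordered by columns, only those in the relevant rectangle contribute, each at most $a_p$; hence every
position that occurs is $\preceq A$ (`preceq_of_isChain`). All these positions have the same row
sums (`finrank_eq_of_isChain`), and for fixed row sums $\preceq$ is antisymmetric
(`eq_of_preceq_preceq`), so those other than $A$ are $\prec A$.

Existence: label a basis indexed by the units of $A$ by their rows, and change the labels from row
to column, one position at a time. The coordinate flags form a chain between a pair in position $A$,
and the $D_p$ are read off (`exists_isChain`). Uniqueness: the dimensions of a flag are the row sums
of the next $D_p+a_pE_p$, hence give $D_p$; its column sums are the dimensions of the following flag
(`IsChain.eq_of_finrank_eq`).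

Polynomiality: an elementary step of size $a+1$ becomes one of size $a$ when a suitable vector is
added to the right flag. The sum over such vectors is polynomial in $q$, since the new position
depends only on the support of the vector in an adapted basis. It overcounts by $q^{m+a+1}-q^m$.
This polynomial is monic, and the quotient takes integer values at all odd primes, so the division
is exact in $\mathbb Z[q]$ (`dvd_of_eval_dvd`, `IsPoly.mul_elemFun`). Transposition treats the
factors below the diagonal. -/

noncomputable section

namespace BLM

open Module

/-! ### Corner sums, relative positions and adapted bases -/

/-- The sum of the entries of `C` in the first `k` rows and the first `l` columns. -/
def corner {n : ℕ} (C : Matrix (Fin n) (Fin n) ℕ) (k l : Fin (n + 1)) : ℕ :=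
  ∑ i with i.castSucc < k, ∑ j with j.castSucc < l, C i j

theorem filter_castSucc_lt_succ {n : ℕ} (i : Fin n) :
    (Finset.univ.filter fun r : Fin n => r.castSucc < i.succ) =
      insert i (Finset.univ.filter fun r : Fin n => r.castSucc < i.castSucc) := by
  ext r
  simp only [Finset.mem_filter, Finset.mem_univ, true_and, Finset.mem_insert, Fin.lt_def,
    Fin.ext_iff, Fin.val_castSucc, Fin.val_succ]
  omega

theorem sum_castSucc_lt_succ {n : ℕ} {M : Type*} [AddCommMonoid M] (f : Fin n → M) (i : Fin n) :
    ∑ r with r.castSucc < i.succ, f r = f i + ∑ r with r.castSucc < i.castSucc, f r := by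
  rw [filter_castSucc_lt_succ, Finset.sum_insert (by simp)]

theorem corner_zero_left {n : ℕ} (C : Matrix (Fin n) (Fin n) ℕ) (l : Fin (n + 1)) :
    corner C 0 l = 0 := by
  simp [corner]

theorem corner_zero_right {n : ℕ} (C : Matrix (Fin n) (Fin n) ℕ) (k : Fin (n + 1)) :
    corner C k 0 = 0 := by
  simp [corner]

theorem corner_rec {n : ℕ} (C : Matrix (Fin n) (Fin n) ℕ) (i j : Fin n) :
    corner C i.succ j.succ + corner C i.castSucc j.castSucc =
      corner C i.succ j.castSucc + corner C i.castSucc j.succ + C i j := by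
  simp only [corner, sum_castSucc_lt_succ, Finset.sum_add_distrib]
  ring

theorem corner_transpose {n : ℕ} (C : Matrix (Fin n) (Fin n) ℕ) (k l : Fin (n + 1)) :
    corner C.transpose k l = corner C l k := by
  simp only [corner, Matrix.transpose_apply]
  exact Finset.sum_comm

theorem corner_last_last {n : ℕ} (C : Matrix (Fin n) (Fin n) ℕ) :
    corner C (Fin.last n) (Fin.last n) = ∑ i, ∑ j, C i j := by
  simp [corner, Fin.castSucc_lt_last]

theorem corner_injective {n : ℕ} {B C : Matrix (Fin n) (Fin n) ℕ}
    (h : ∀ k l, corner B k l = corner C k l) : B = C := by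
  ext i j
  have h1 := corner_rec B i j
  have h2 := corner_rec C i j
  simp only [h] at h1
  omega

theorem eq_corner_of_rec {n : ℕ} (C : Matrix (Fin n) (Fin n) ℕ) (r : Fin (n + 1) → Fin (n + 1) → ℕ)
    (h0 : ∀ l, r 0 l = 0) (h0' : ∀ k, r k 0 = 0)
    (h : ∀ i j : Fin n, r i.succ j.succ + r i.castSucc j.castSucc =
      r i.succ j.castSucc + r i.castSucc j.succ + C i j) (k l : Fin (n + 1)) :
    r k l = corner C k l := by
  induction k using Fin.induction generalizing l with
  | zero => rw [h0, corner_zero_left]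
  | succ i ih =>
    induction l using Fin.induction with
    | zero => rw [h0', corner_zero_right]
    | succ j ihj =>
      have h1 := h i j
      have h2 := corner_rec C i j
      rw [ihj, ih, ih] at h1
      omega

variable {K : Type} [Field K] {n d : ℕ}

/-- The dimension of `V_k ∩ V'_l`. -/
def meetDim (V V' : Flag K n d) (k l : Fin (n + 1)) : ℕ :=
  finrank K ↥(V.space k ⊓ V'.space l)

theorem meetDim_comm (V V' : Flag K n d) (k l : Fin (n + 1)) :
    meetDim V V' k l = meetDim V' V l k := by
  rw [meetDim, meetDim, inf_comm]

theorem Flag.castSucc_le_succ (V : Flag K n d) (i : Fin n) :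
    V.space i.castSucc ≤ V.space i.succ :=
  V.mono (Fin.castSucc_lt_succ).le

theorem finrank_sup_meet (V V' : Flag K n d) (i : Fin n) (l : Fin (n + 1)) :
    finrank K ↥(V.space i.castSucc ⊔ V.space i.succ ⊓ V'.space l) + meetDim V V' i.castSucc l =
      finrank K (V.space i.castSucc) + meetDim V V' i.succ l := by
  have h := Submodule.finrank_sup_add_finrank_inf_eq (V.space i.castSucc)
    (V.space i.succ ⊓ V'.space l)
  rwa [← inf_assoc, inf_eq_left.mpr (V.castSucc_le_succ i)] at h

/-- The dimension formula turns the quotient in `relPos` into a second difference of the numbers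
$\dim(V_k\cap V'_l)$. This is the recursion satisfied by corner sums, so these dimensions carry the
same information as the relative position. -/
theorem relPos_add (V V' : Flag K n d) (i j : Fin n) :
    meetDim V V' i.succ j.succ + meetDim V V' i.castSucc j.castSucc =
      meetDim V V' i.succ j.castSucc + meetDim V V' i.castSucc j.succ + relPos V V' i j := by
  have h1 := finrank_sup_meet V V' i j.succ
  have h2 := finrank_sup_meet V V' i j.castSucc
  have hle : V.space i.castSucc ⊔ V.space i.succ ⊓ V'.space j.castSucc ≤
      V.space i.castSucc ⊔ V.space i.succ ⊓ V'.space j.succ :=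
    sup_le_sup le_rfl (inf_le_inf le_rfl (V'.castSucc_le_succ j))
  have h3 := Submodule.finrank_quotient_add_finrank
    ((V.space i.castSucc ⊔ V.space i.succ ⊓ V'.space j.castSucc).submoduleOf
      (V.space i.castSucc ⊔ V.space i.succ ⊓ V'.space j.succ))
  rw [(Submodule.submoduleOfEquivOfLe hle).finrank_eq] at h3
  change relPos V V' i j + _ = _ at h3
  omega

theorem meetDim_eq_corner (V V' : Flag K n d) (k l : Fin (n + 1)) :
    meetDim V V' k l = corner (relPos V V') k l := by
  refine eq_corner_of_rec _ _ (fun l => ?_) (fun k => ?_) (relPos_add V V') k l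
  · simp [meetDim, V.first]
  · simp [meetDim, V'.first]

theorem relPos_eq_iff (V V' : Flag K n d) (C : Matrix (Fin n) (Fin n) ℕ) :
    relPos V V' = C ↔ ∀ k l, meetDim V V' k l = corner C k l := by
  refine ⟨?_, fun h => corner_injective fun k l => ?_⟩
  · rintro rfl k l
    exact meetDim_eq_corner V V' k l
  · rw [← meetDim_eq_corner, h]

theorem relPos_swap (V V' : Flag K n d) : relPos V' V = (relPos V V').transpose := by
  rw [relPos_eq_iff]
  intro k l
  rw [corner_transpose, ← meetDim_eq_corner, meetDim_comm]

theorem meetDim_last_right (V V' : Flag K n d) (k : Fin (n + 1)) :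
    meetDim V V' k (Fin.last n) = finrank K (V.space k) := by
  rw [meetDim, V'.last, inf_top_eq]

theorem finrank_left (V V' : Flag K n d) (k : Fin (n + 1)) :
    finrank K (V.space k) = corner (relPos V V') k (Fin.last n) := by
  rw [← meetDim_eq_corner, meetDim_last_right]

theorem finrank_right (V V' : Flag K n d) (k : Fin (n + 1)) :
    finrank K (V'.space k) = corner (relPos V V') (Fin.last n) k := by
  rw [← meetDim_eq_corner, meetDim_comm, meetDim_last_right]

theorem relPos_mem_Theta (V V' : Flag K n d) : relPos V V' ∈ Theta n d := by
  change _ = _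
  rw [← corner_last_last, ← finrank_left, V.last, finrank_top, finrank_fin_fun]

/-- A set of independent representatives for the quotient of nested subspaces. -/
theorem exists_family_sup_span_eq {E : Type*} [AddCommGroup E] [Module K E] [FiniteDimensional K E]
    {S R : Submodule K E} (h : R ≤ S) {c : ℕ} (hc : finrank K S = finrank K R + c) :
    ∃ w : Fin c → E, S = R ⊔ Submodule.span K (Set.range w) := by
  obtain ⟨W, hW⟩ := Submodule.exists_isCompl R
  have hsup : R ⊔ W ⊓ S = S := by
    rw [← sup_inf_assoc_of_le W h, hW.sup_eq_top, top_inf_eq]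
  have hinf : R ⊓ (W ⊓ S) = ⊥ := by
    rw [← inf_assoc, hW.inf_eq_bot, bot_inf_eq]
  have hdim := Submodule.finrank_sup_add_finrank_inf_eq R (W ⊓ S)
  rw [hsup, hinf, finrank_bot] at hdim
  let b := finBasisOfFinrankEq K ↥(W ⊓ S) (n := c) (by omega)
  refine ⟨fun x => (b x : E), ?_⟩
  have : Submodule.span K (Set.range fun x => (b x : E)) = W ⊓ S := by
    have h2 := congrArg (Submodule.map (W ⊓ S).subtype) b.span_eq
    rw [Submodule.map_span, ← Set.range_comp, Submodule.map_top, Submodule.range_subtype] at h2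
    exact h2
  rw [this, hsup]

/-- A flag is adapted to a basis with labels `f` if `V_k` is spanned by the basis vectors with
label below `k`. -/
def IsAdapted {ι : Type*} (V : Flag K n d) (b : Basis ι K (Fin d → K)) (f : ι → Fin n) : Prop :=
  ∀ k v, v ∈ V.space k ↔ ∀ x, b.repr v x ≠ 0 → (f x).castSucc < k

/-- The units of a matrix over `ℕ`. -/
abbrev Cells {n : ℕ} (C : Matrix (Fin n) (Fin n) ℕ) : Type :=
  Σ p : Fin n × Fin n, Fin (C p.1 p.2)

theorem card_cells (C : Matrix (Fin n) (Fin n) ℕ) : Fintype.card (Cells C) = ∑ i, ∑ j, C i j := by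
  simp [Fintype.card_sigma, Fintype.sum_prod_type]

/-- For each cell, take representatives of a basis of $V_i\cap V'_j$ modulo $V_{i-1}\cap
V'_j+V_i\cap V'_{j-1}$. Double induction on the indices shows that they span every $V_k\cap V'_l$;
there are $d$ of them in all, so they form a basis. -/
theorem exists_adapted_basis (V V' : Flag K n d) :
    ∃ b : Basis (Cells (relPos V V')) K (Fin d → K),
      IsAdapted V b (fun x => x.1.1) ∧ IsAdapted V' b (fun x => x.1.2) := by
  have hrep : ∀ p : Fin n × Fin n, ∃ w : Fin (relPos V V' p.1 p.2) → (Fin d → K),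
      V.space p.1.succ ⊓ V'.space p.2.succ =
        (V.space p.1.castSucc ⊓ V'.space p.2.succ ⊔ V.space p.1.succ ⊓ V'.space p.2.castSucc) ⊔
          Submodule.span K (Set.range w) := by
    rintro ⟨i, j⟩
    refine exists_family_sup_span_eq (sup_le (inf_le_inf (V.castSucc_le_succ i) le_rfl)
      (inf_le_inf le_rfl (V'.castSucc_le_succ j))) ?_
    have h := Submodule.finrank_sup_add_finrank_inf_eq
      (V.space i.castSucc ⊓ V'.space j.succ) (V.space i.succ ⊓ V'.space j.castSucc)
    have h2 : V.space i.castSucc ⊓ V'.space j.succ ⊓ (V.space i.succ ⊓ V'.space j.castSucc) =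
        V.space i.castSucc ⊓ V'.space j.castSucc := by
      rw [inf_inf_inf_comm, inf_eq_left.mpr (V.castSucc_le_succ i),
        inf_eq_right.mpr (V'.castSucc_le_succ j)]
    rw [h2] at h
    have h3 := relPos_add V V' i j
    simp only [meetDim] at h3
    dsimp only
    omega
  choose w hw using hrep
  let u : Cells (relPos V V') → (Fin d → K) := fun x => w x.1 x.2
  have hspan : ∀ k l : Fin (n + 1), V.space k ⊓ V'.space l ≤
      Submodule.span K (u '' {x | x.1.1.castSucc < k ∧ x.1.2.castSucc < l}) := by
    intro k
    induction k using Fin.induction with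
    | zero => intro l; simp [V.first]
    | succ i ih =>
      intro l
      induction l using Fin.induction with
      | zero => simp [V'.first]
      | succ j ihj =>
        rw [hw (i, j)]
        refine sup_le (sup_le ((ih j.succ).trans ?_) (ihj.trans ?_)) ?_
        · refine Submodule.span_mono (Set.image_mono ?_)
          rintro x ⟨h1, h2⟩
          exact ⟨h1.trans Fin.castSucc_lt_succ, h2⟩
        · refine Submodule.span_mono (Set.image_mono ?_)
          rintro x ⟨h1, h2⟩
          exact ⟨h1, h2.trans Fin.castSucc_lt_succ⟩
        · refine Submodule.span_mono ?_
          rintro _ ⟨x, rfl⟩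
          exact ⟨⟨(i, j), x⟩, ⟨Fin.castSucc_lt_succ, Fin.castSucc_lt_succ⟩, rfl⟩
  have hu : ∀ x, u x ∈ V.space x.1.1.succ ⊓ V'.space x.1.2.succ := by
    intro x
    rw [hw x.1]
    exact Submodule.mem_sup_right (Submodule.subset_span ⟨x.2, rfl⟩)
  have htop : ⊤ ≤ Submodule.span K (Set.range u) := by
    have h := hspan (Fin.last n) (Fin.last n)
    rw [V.last, V'.last, inf_top_eq] at h
    exact h.trans (Submodule.span_mono (Set.image_subset_range _ _))
  have hcard : Fintype.card (Cells (relPos V V')) = finrank K (Fin d → K) := by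
    rw [card_cells, finrank_fin_fun]
    exact relPos_mem_Theta V V'
  let b := basisOfTopLeSpanOfCardEqFinrank u htop hcard
  have hb : ⇑b = u := coe_basisOfTopLeSpanOfCardEqFinrank u htop hcard
  have key : ∀ (S : Set (Cells (relPos V V'))) v, v ∈ Submodule.span K (u '' S) →
      ∀ x, b.repr v x ≠ 0 → x ∈ S := by
    intro S v hv x hx
    rw [← hb, b.mem_span_image] at hv
    exact hv (by simpa using hx)
  refine ⟨b, fun k v => ⟨fun hv x hx => ?_, fun hv => ?_⟩, fun k v => ⟨fun hv x hx => ?_, fun hv => ?_⟩⟩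
  · have h := hspan k (Fin.last n)
    rw [V'.last, inf_top_eq] at h
    exact (key _ v (h hv) x hx).1
  · rw [← b.sum_repr v]
    refine Submodule.sum_mem _ fun x _ => ?_
    by_cases hx : b.repr v x = 0
    · simp [hx]
    · refine Submodule.smul_mem _ _ ?_
      rw [hb]
      exact V.mono (Fin.castSucc_lt_iff_succ_le.mp (hv x hx)) (hu x).1
  · have h := hspan (Fin.last n) k
    rw [V.last, top_inf_eq] at h
    exact (key _ v (h hv) x hx).2
  · rw [← b.sum_repr v]
    refine Submodule.sum_mem _ fun x _ => ?_
    by_cases hx : b.repr v x = 0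
    · simp [hx]
    · refine Submodule.smul_mem _ _ ?_
      rw [hb]
      exact V'.mono (Fin.castSucc_lt_iff_succ_le.mp (hv x hx)) (hu x).2

/-- The flag spanned by the basis vectors with labels below `k`. -/
def coordFlag {ι : Type*} (b : Basis ι K (Fin d → K)) (f : ι → Fin n) : Flag K n d where
  space k :=
    { carrier := {v | ∀ x, ¬ (f x).castSucc < k → b.repr v x = 0}
      add_mem' := fun ha hb x hx => by simp [ha x hx, hb x hx]
      zero_mem' := fun x _ => by simp
      smul_mem' := fun c v hv x hx => by simp [hv x hx] }
  mono := fun _ _ hkl _ hv x hx => hv x fun h => hx (h.trans_le hkl)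
  first := by
    ext v
    constructor
    · intro hv
      exact b.repr.map_eq_zero_iff.mp (Finsupp.ext fun x => hv x (Fin.not_lt_zero _))
    · rintro rfl x _
      simp
  last := by
    ext v
    exact ⟨fun _ => trivial, fun _ x hx => (hx (Fin.castSucc_lt_last _)).elim⟩

theorem isAdapted_coordFlag {ι : Type*} (b : Basis ι K (Fin d → K)) (f : ι → Fin n) :
    IsAdapted (coordFlag b f) b f :=
  fun _ _ => forall_congr' fun _ => not_imp_comm

theorem relPos_of_isAdapted {ι : Type*} [Fintype ι] {V V' : Flag K n d}
    {b : Basis ι K (Fin d → K)} {f g : ι → Fin n} (hV : IsAdapted V b f) (hV' : IsAdapted V' b g)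
    (i j : Fin n) : relPos V V' i j = (Finset.univ.filter fun x => f x = i ∧ g x = j).card := by
  classical
  suffices h : relPos V V' = Matrix.of fun i j =>
      (Finset.univ.filter fun x => f x = i ∧ g x = j).card by
    rw [h, Matrix.of_apply]
  rw [relPos_eq_iff]
  intro k l
  have h1 : V.space k ⊓ V'.space l =
      Submodule.span K (b '' {x | (f x).castSucc < k ∧ (g x).castSucc < l}) := by
    ext v
    rw [Submodule.mem_inf, hV, hV', b.mem_span_image, ← forall_and]
    refine forall_congr' fun x => ?_
    rw [← imp_and, Finset.mem_coe, Finsupp.mem_support_iff]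
    rfl
  have h2 := finrank_span_set_eq_card (b.linearIndependent.linearIndepOn_id.mono
    (Set.image_subset_range b {x | (f x).castSucc < k ∧ (g x).castSucc < l}))
  rw [meetDim, h1, h2, Set.toFinset_card, Set.card_image_of_injective _ b.injective,
    Fintype.card_subtype]
  simp only [corner, Set.mem_ofPred_eq, Matrix.of_apply]
  rw [Finset.card_eq_sum_card_fiberwise (f := fun x => (f x, g x))
    (t := (Finset.univ.filter fun i : Fin n => i.castSucc < k) ×ˢ
      (Finset.univ.filter fun i : Fin n => i.castSucc < l)), Finset.sum_product]
  · refine Finset.sum_congr rfl fun i hi => Finset.sum_congr rfl fun j hj => ?_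
    congr 1
    ext x
    simp only [Finset.mem_filter, Finset.mem_univ, true_and, Prod.mk.injEq] at hi hj ⊢
    constructor
    · exact fun h => h.2
    · rintro ⟨rfl, rfl⟩
      exact ⟨⟨hi, hj⟩, rfl, rfl⟩
  · intro x hx
    simpa using hx

theorem mem_sup_iff_of_isAdapted {ι : Type*} [Fintype ι] {V V' : Flag K n d}
    {b : Basis ι K (Fin d → K)} {f g : ι → Fin n} (hV : IsAdapted V b f) (hV' : IsAdapted V' b g)
    (k l : Fin (n + 1)) (v : Fin d → K) :
    v ∈ V.space k ⊔ V'.space l ↔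
      ∀ x, b.repr v x ≠ 0 → (f x).castSucc < k ∨ (g x).castSucc < l := by
  constructor
  · intro hv x hx
    obtain ⟨y, hy, z, hz, rfl⟩ := Submodule.mem_sup.mp hv
    by_contra! h
    have h1 : b.repr y x = 0 := by
      by_contra h1
      exact absurd ((hV k y).mp hy x h1) h.1.not_gt
    have h2 : b.repr z x = 0 := by
      by_contra h2
      exact absurd ((hV' l z).mp hz x h2) h.2.not_gt
    simp [h1, h2] at hx
  · intro hv
    rw [← b.sum_repr v]
    refine Submodule.sum_mem _ fun x _ => ?_
    by_cases hx : b.repr v x = 0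
    · simp [hx]
    · refine Submodule.smul_mem _ _ ?_
      classical
      have hb : ∀ z, b.repr (b x) z ≠ 0 → z = x := by
        intro z hz
        rw [b.repr_self, Finsupp.single_apply] at hz
        by_contra hne
        exact hz (if_neg fun h => hne h.symm)
      rcases hv x hx with h | h
      · exact Submodule.mem_sup_left ((hV k _).mpr fun z hz => hb z hz ▸ h)
      · exact Submodule.mem_sup_right ((hV' l _).mpr fun z hz => hb z hz ▸ h)

theorem basis_mem_iff_of_isAdapted {ι : Type*} {V : Flag K n d}
    {b : Basis ι K (Fin d → K)} {f : ι → Fin n} (hV : IsAdapted V b f)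
    (k : Fin (n + 1)) (x : ι) : b x ∈ V.space k ↔ (f x).castSucc < k := by
  classical
  rw [hV]
  simp only [b.repr_self, Finsupp.single_apply, ne_eq, ite_eq_right_iff, one_ne_zero, imp_false,
    not_not]
  exact ⟨fun h => h x rfl, fun h z hz => hz ▸ h⟩

end BLM

end

/-! ### Adding one vector to a flag; elementary relative positions -/

noncomputable section

namespace BLM

open Module

section AddVec

variable {K : Type} [Field K] {n d : ℕ}

theorem finrank_sup_span_singleton {E : Type*} [AddCommGroup E] [Module K E]
    [FiniteDimensional K E] {W : Submodule K E} {y : E} (hy : y ∉ W) :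
    finrank K ↥(W ⊔ Submodule.span K {y}) = finrank K W + 1 := by
  have hy0 : y ≠ 0 := fun h => hy (h ▸ W.zero_mem)
  have h := Submodule.finrank_sup_add_finrank_inf_eq W (Submodule.span K {y})
  rw [((Submodule.disjoint_span_singleton' hy0).mpr hy).eq_bot, finrank_bot,
    finrank_span_singleton hy0] at h
  exact h

-- Compare the dimension formulas for $U+W$ and $U+W+Ky$: the sum and the intersection cannot both
-- grow, and exactly one of them does.
open Classical in
theorem finrank_inf_sup_span_singleton {E : Type*} [AddCommGroup E] [Module K E]
    [FiniteDimensional K E] (U : Submodule K E) {W : Submodule K E} {y : E} (hy : y ∉ W) :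
    finrank K ↥(U ⊓ (W ⊔ Submodule.span K {y})) =
      finrank K ↥(U ⊓ W) + if y ∈ U ⊔ W then 1 else 0 := by
  have h1 := Submodule.finrank_sup_add_finrank_inf_eq U (W ⊔ Submodule.span K {y})
  have h2 := Submodule.finrank_sup_add_finrank_inf_eq U W
  rw [finrank_sup_span_singleton hy, ← sup_assoc] at h1
  split_ifs with h
  · rw [sup_eq_left.mpr (Submodule.span_le.mpr (Set.singleton_subset_iff.mpr h))] at h1
    omega
  · rw [finrank_sup_span_singleton h] at h1
    omega

open Classical in
/-- The flag obtained from `V` by adding a vector `y ∈ V_{j+1}` to the spaces `V_k`,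
`i < k ≤ j`. -/
def addVec (V : Flag K n d) (i j : Fin n) (y : Fin d → K) : Flag K n d where
  -- Cutting the line down to $V_{j+1}$ makes this a flag for every $y$; for $y\in V_{j+1}$ the cut
  -- changes nothing.
  space k := if i.castSucc < k ∧ k ≤ j.castSucc then
    V.space k ⊔ Submodule.span K {y} ⊓ V.space j.succ else V.space k
  mono := by
    intro k l hkl
    have h := V.mono hkl
    by_cases hk : i.castSucc < k ∧ k ≤ j.castSucc
    · by_cases hl : i.castSucc < l ∧ l ≤ j.castSucc
      · simp only [if_pos hk, if_pos hl]
        exact sup_le_sup h le_rfl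
      · simp only [if_pos hk, if_neg hl]
        have hjl : j.castSucc < l := not_le.mp fun h' => hl ⟨hk.1.trans_le hkl, h'⟩
        exact sup_le h (inf_le_right.trans (V.mono (Fin.castSucc_lt_iff_succ_le.mp hjl)))
    · simp only [if_neg hk]
      split_ifs
      · exact h.trans le_sup_left
      · exact h
  first := by
    rw [if_neg fun h => Fin.not_lt_zero _ h.1]
    exact V.first
  last := by
    rw [if_neg fun h => h.2.not_gt (Fin.castSucc_lt_last j)]
    exact V.last

theorem addVec_space_of_mem {V : Flag K n d} {i j : Fin n} {y : Fin d → K}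
    (hy : y ∈ V.space j.succ) {k : Fin (n + 1)} (h1 : i.castSucc < k) (h2 : k ≤ j.castSucc) :
    (addVec V i j y).space k = V.space k ⊔ Submodule.span K {y} := by
  change (if _ then _ else _) = _
  rw [if_pos ⟨h1, h2⟩,
    inf_eq_left.mpr (Submodule.span_le.mpr (Set.singleton_subset_iff.mpr hy))]

theorem addVec_space_of_not {V : Flag K n d} {i j : Fin n} {y : Fin d → K}
    {k : Fin (n + 1)} (h : ¬ (i.castSucc < k ∧ k ≤ j.castSucc)) :
    (addVec V i j y).space k = V.space k := by
  change (if _ then _ else _) = _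
  rw [if_neg h]

open Classical in
theorem meetDim_addVec (V V' : Flag K n d) {i j : Fin n} {y : Fin d → K}
    (hy : y ∈ V'.space j.succ) (hy' : y ∉ V'.space j.castSucc) (k l : Fin (n + 1)) :
    meetDim V (addVec V' i j y) k l = meetDim V V' k l +
      if (i.castSucc < l ∧ l ≤ j.castSucc) ∧ y ∈ V.space k ⊔ V'.space l then 1 else 0 := by
  by_cases h : i.castSucc < l ∧ l ≤ j.castSucc
  · rw [meetDim, addVec_space_of_mem hy h.1 h.2,
      finrank_inf_sup_span_singleton _ fun hm => hy' (V'.mono h.2 hm), meetDim]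
    simp only [h, true_and]
  · rw [meetDim, addVec_space_of_not h, meetDim, if_neg fun hh => h hh.1, add_zero]

open Classical in
/-- The corner sums of the matrix of `(V, V'[y])`, for `y` with support `Z`. -/
def shiftCorner (C : Matrix (Fin n) (Fin n) ℕ) (i j : Fin n) (Z : Finset (Cells C))
    (k l : Fin (n + 1)) : ℕ :=
  corner C k l + if (i.castSucc < l ∧ l ≤ j.castSucc) ∧
    ∀ x ∈ Z, x.1.1.castSucc < k ∨ x.1.2.castSucc < l then 1 else 0

/-- The matrix of `(V, V'[y])`, for `y` with support `Z`. -/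
def shiftMatrix (C : Matrix (Fin n) (Fin n) ℕ) (i j : Fin n) (Z : Finset (Cells C)) :
    Matrix (Fin n) (Fin n) ℕ :=
  Matrix.of fun r s =>
    -- The subtraction does not truncate for the support of a vector as in `relPos_addVec`: the
    -- difference is then an entry of a relative position.
    shiftCorner C i j Z r.succ s.succ + shiftCorner C i j Z r.castSucc s.castSucc -
      (shiftCorner C i j Z r.succ s.castSucc + shiftCorner C i j Z r.castSucc s.succ)

theorem relPos_addVec {V V' : Flag K n d} {b : Basis (Cells (relPos V V')) K (Fin d → K)}
    (hV : IsAdapted V b (fun x => x.1.1)) (hV' : IsAdapted V' b (fun x => x.1.2))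
    {i j : Fin n} {y : Fin d → K} (hy : y ∈ V'.space j.succ) (hy' : y ∉ V'.space j.castSucc) :
    relPos V (addVec V' i j y) = shiftMatrix (relPos V V') i j (b.repr y).support := by
  have h : ∀ k l, meetDim V (addVec V' i j y) k l =
      shiftCorner (relPos V V') i j (b.repr y).support k l := by
    intro k l
    rw [meetDim_addVec V V' hy hy', shiftCorner, meetDim_eq_corner]
    congr 2
    rw [mem_sup_iff_of_isAdapted hV hV']
    simp only [Finsupp.mem_support_iff]
  ext r s
  have h1 := relPos_add V (addVec V' i j y) r s
  rw [h, h, h, h] at h1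
  rw [shiftMatrix, Matrix.of_apply]
  omega

open Classical in
theorem card_support_eq {ι : Type*} [Fintype ι] [Fintype K] (Z : Finset ι) :
    (Finset.univ.filter fun y : ι → K => (Finset.univ.filter fun x => y x ≠ 0) = Z).card =
      (Fintype.card K - 1) ^ Z.card := by
  have h : (Finset.univ.filter fun y : ι → K => (Finset.univ.filter fun x => y x ≠ 0) = Z) =
      Fintype.piFinset fun x => if x ∈ Z then Finset.univ.erase (0 : K) else {0} := by
    ext y
    simp only [Finset.mem_filter, Finset.mem_univ, true_and, Fintype.mem_piFinset,
      Finset.ext_iff]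
    refine forall_congr' fun x => ?_
    split_ifs with hx <;> simp [hx]
  rw [h, Fintype.card_piFinset, Fintype.prod_congr _
    (fun x => if x ∈ Z then Fintype.card K - 1 else 1) fun x => by split_ifs <;> simp]
  simp

theorem sum_basis_support {ι : Type*} [Fintype ι] [Fintype K] (b : Basis ι K (Fin d → K))
    (φ : Finset ι → ℝ) :
    ∑ y : Fin d → K, φ (b.repr y).support =
      ∑ Z : Finset ι, ((Fintype.card K : ℝ) - 1) ^ Z.card * φ Z := by
  classical
  rw [Fintype.sum_equiv b.equivFun.toEquiv (fun y => φ (b.repr y).support)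
    (fun y : ι → K => φ (Finset.univ.filter fun x => y x ≠ 0)) fun y => by
      congr 1
      ext x
      rw [Finsupp.mem_support_iff, Finset.mem_filter]
      simp]
  rw [← Finset.sum_fiberwise_of_maps_to (s := Finset.univ) (t := (Finset.univ : Finset (Finset ι)))
    (g := fun y : ι → K => Finset.univ.filter fun x => y x ≠ 0) fun _ _ => Finset.mem_univ _]
  refine Finset.sum_congr rfl fun Z _ => ?_
  rw [Finset.sum_congr rfl fun y hy => congrArg φ (Finset.mem_filter.mp hy).2,
    Finset.sum_const, nsmul_eq_mul]
  congr 1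
  rw [card_support_eq, Nat.cast_pow, Nat.cast_sub Fintype.card_pos, Nat.cast_one]

open Classical in
/-- The vectors of `V_{j+1}` outside `V_j`. -/
def newVecs [Fintype K] (V : Flag K n d) (j : Fin n) : Finset (Fin d → K) :=
  Finset.univ.filter fun y => y ∈ V.space j.succ ∧ y ∉ V.space j.castSucc

-- Both the condition on $y$ and the resulting position depend only on the support $Z$ of $y$ in a
-- common adapted basis, and $(q-1)^{|Z|}$ vectors have support $Z$. The right side is therefore
-- polynomial in $q$ whenever $\varphi$ is.
open Classical in
theorem sum_newVecs [Fintype K] (V V' : Flag K n d) (i j : Fin n)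
    (φ : Matrix (Fin n) (Fin n) ℕ → ℝ) :
    ∑ y ∈ newVecs V' j, φ (relPos V (addVec V' i j y)) =
      ∑ Z : Finset (Cells (relPos V V')), ((Fintype.card K : ℝ) - 1) ^ Z.card *
        if (∀ x ∈ Z, x.1.2.castSucc < j.succ) ∧ ¬ (∀ x ∈ Z, x.1.2.castSucc < j.castSucc) then
          φ (shiftMatrix (relPos V V') i j Z) else 0 := by
  obtain ⟨b, hV, hV'⟩ := exists_adapted_basis V V'
  rw [← sum_basis_support b fun Z =>
    if (∀ x ∈ Z, x.1.2.castSucc < j.succ) ∧ ¬ (∀ x ∈ Z, x.1.2.castSucc < j.castSucc) then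
      φ (shiftMatrix (relPos V V') i j Z) else 0, newVecs, Finset.sum_filter]
  refine Finset.sum_congr rfl fun y _ => ?_
  have h : (y ∈ V'.space j.succ ∧ y ∉ V'.space j.castSucc) ↔
      ((∀ x ∈ (b.repr y).support, x.1.2.castSucc < j.succ) ∧
        ¬ (∀ x ∈ (b.repr y).support, x.1.2.castSucc < j.castSucc)) := by
    rw [hV', hV']
    simp only [Finsupp.mem_support_iff]
  by_cases hy : y ∈ V'.space j.succ ∧ y ∉ V'.space j.castSucc
  · rw [if_pos hy, if_pos (h.mp hy), relPos_addVec hV hV' hy.1 hy.2]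
  · rw [if_neg hy, if_neg (mt h.mpr hy)]

/-- The lattice-theoretic form of the relation `relPos V V' = D + a E_{ij}`, for `i < j`. -/
structure IsElementary (i j : Fin n) (a : ℕ) (V V' : Flag K n d) : Prop where
  le : ∀ k, V'.space k ≤ V.space k
  eq : ∀ k, ¬ (i.castSucc < k ∧ k ≤ j.castSucc) → V.space k = V'.space k
  le_sup : ∀ k, i.castSucc < k → k ≤ j.castSucc → V.space k ≤ V'.space k ⊔ V.space i.succ
  inf_le : V.space i.succ ⊓ V'.space j.castSucc ≤ V'.space i.succ
  dim : finrank K (V.space i.succ) = finrank K (V'.space i.succ) + a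

open Classical in
theorem corner_diagonal_add_single (D : Fin n → ℕ) (i j : Fin n) (a : ℕ) (k l : Fin (n + 1)) :
    corner (Matrix.diagonal D + Matrix.single i j a) k l =
      (∑ t with t.castSucc < k ∧ t.castSucc < l, D t) +
        if i.castSucc < k ∧ j.castSucc < l then a else 0 := by
  simp only [corner, Matrix.add_apply, Finset.sum_add_distrib]
  congr 1
  · rw [← Finset.filter_filter, Finset.sum_filter (fun t : Fin n => t.castSucc < l)]
    refine Finset.sum_congr rfl fun t _ => ?_
    simp only [Matrix.diagonal_apply]
    rw [Finset.sum_ite_eq]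
    simp
  · simp only [Matrix.single_apply, ite_and, Finset.sum_ite_irrel, Finset.sum_const_zero,
      Finset.sum_ite_eq, Finset.mem_filter, Finset.mem_univ, true_and]

theorem isElementary_of_relPos {i j : Fin n} (hij : i < j) {a : ℕ} {V V' : Flag K n d}
    {D : Fin n → ℕ} (h : relPos V V' = Matrix.diagonal D + Matrix.single i j a) :
    IsElementary i j a V V' := by
  obtain ⟨b, hV, hV'⟩ := exists_adapted_basis V V'
  have hx : ∀ x : Cells (relPos V V'), x.1.1 = x.1.2 ∨ (x.1.1 = i ∧ x.1.2 = j) := by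
    rintro ⟨⟨r, s⟩, t⟩
    by_contra! hne
    have h0 : relPos V V' r s = 0 := by
      rw [h, Matrix.add_apply, Matrix.diagonal_apply_ne _ hne.1, Matrix.single_apply,
        if_neg fun hh => hne.2 hh.1.symm hh.2.symm, add_zero]
    exact absurd t.2 (by simp only [h0]; omega)
  have hij' : (i : ℕ) < j := hij
  have memV : ∀ k v, v ∈ V.space k ↔ ∀ x, b.repr v x ≠ 0 → x.1.1.castSucc < k := hV
  have memV' : ∀ k v, v ∈ V'.space k ↔ ∀ x, b.repr v x ≠ 0 → x.1.2.castSucc < k := hV'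
  have hle : ∀ k, V'.space k ≤ V.space k := by
    intro k v hv
    rw [memV]
    rw [memV'] at hv
    intro x hxv
    have := hv x hxv
    rcases hx x with h1 | ⟨h1, h2⟩
    · rwa [h1]
    · rw [h1]
      rw [h2] at this
      exact (Fin.castSucc_lt_castSucc_iff.mpr hij).trans this
  refine ⟨hle, fun k hk => le_antisymm (fun v hv => ?_) (hle k), fun k h1 h2 v hv => ?_,
    fun v hv => ?_, ?_⟩
  · rw [memV] at hv
    rw [memV']
    intro x hxv
    have := hv x hxv
    rcases hx x with h1 | ⟨h1, h2⟩
    · rwa [← h1]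
    · rw [h1] at this
      rw [h2]
      exact not_le.mp fun h' => hk ⟨this, h'⟩
  · rw [sup_comm, mem_sup_iff_of_isAdapted hV hV']
    rw [memV] at hv
    intro x hxv
    rcases hx x with h3 | ⟨h3, h4⟩
    · exact Or.inr (h3 ▸ hv x hxv)
    · exact Or.inl (h3 ▸ Fin.castSucc_lt_succ)
  · obtain ⟨hv1, hv2⟩ := hv
    rw [SetLike.mem_coe, memV] at hv1
    rw [SetLike.mem_coe, memV'] at hv2
    rw [memV']
    intro x hxv
    rcases hx x with h3 | ⟨h3, h4⟩
    · exact h3 ▸ hv1 x hxv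
    · exact absurd (hv2 x hxv) (by rw [h4]; exact lt_irrefl _)
  · rw [finrank_left V V', finrank_right V V', h, corner_diagonal_add_single,
      corner_diagonal_add_single, if_pos ⟨Fin.castSucc_lt_succ, Fin.castSucc_lt_last _⟩, if_neg]
    · simp only [and_comm, add_zero]
    · rintro ⟨-, h2⟩
      simp only [Fin.lt_def, Fin.val_castSucc, Fin.val_succ] at h2
      omega

/-- A unit of a common adapted basis off the diagonal lies above it, since $V'\le V$. The conditions
`eq` and `le_sup` then force its row to be $i$; `inf_le` excludes columns before $j$ and `eq` those
after $j$. -/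
theorem exists_relPos_of_isElementary {i j : Fin n} (hij : i < j) {a : ℕ} {V V' : Flag K n d}
    (h : IsElementary i j a V V') :
    relPos V V' = Matrix.diagonal (fun t => relPos V V' t t) + Matrix.single i j a := by
  obtain ⟨b, hV, hV'⟩ := exists_adapted_basis V V'
  have hx : ∀ x : Cells (relPos V V'), x.1.1 = x.1.2 ∨ (x.1.1 = i ∧ x.1.2 = j) := by
    intro x
    by_contra! hne
    have hle : x.1.1 ≤ x.1.2 := by
      have := h.le x.1.2.succ ((basis_mem_iff_of_isAdapted hV' _ x).mpr Fin.castSucc_lt_succ)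
      rw [basis_mem_iff_of_isAdapted hV] at this
      simp only [Fin.lt_def, Fin.le_def, Fin.val_castSucc, Fin.val_succ] at this ⊢
      omega
    have hlt : x.1.1 < x.1.2 := lt_of_le_of_ne hle hne.1
    have hmem : b x ∈ V.space x.1.1.succ :=
      (basis_mem_iff_of_isAdapted hV _ x).mpr Fin.castSucc_lt_succ
    have hnot : ∀ k : Fin (n + 1), k ≤ x.1.2.castSucc → b x ∉ V'.space k := fun k hk hm =>
      absurd ((basis_mem_iff_of_isAdapted hV' _ x).mp hm) hk.not_gt
    have hsucc : x.1.1.succ ≤ x.1.2.castSucc :=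
      Fin.castSucc_lt_iff_succ_le.mp (Fin.castSucc_lt_castSucc_iff.mpr hlt)
    by_cases hk : i.castSucc < x.1.1.succ ∧ x.1.1.succ ≤ j.castSucc
    · have h1 := h.le_sup _ hk.1 hk.2 hmem
      rw [sup_comm, mem_sup_iff_of_isAdapted hV hV'] at h1
      have h2 := h1 x (by simp)
      have h3 : x.1.1 = i := by
        simp only [Fin.lt_def, Fin.le_def, Fin.ext_iff, Fin.val_castSucc, Fin.val_succ] at *
        omega
      have h4 : x.1.2.castSucc < j.castSucc → False := fun hlt' => by
        have := h.inf_le ⟨h3 ▸ hmem, (basis_mem_iff_of_isAdapted hV' _ x).mpr hlt'⟩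
        exact hnot _ (h3 ▸ hsucc) this
      have h5 : ¬ j.castSucc < x.1.2.castSucc := fun hlt' => by
        have h6 : b x ∈ V.space x.1.2.castSucc := V.mono hsucc hmem
        rw [h.eq _ fun hh => hh.2.not_gt hlt'] at h6
        exact hnot _ le_rfl h6
      exact hne.2 h3 (Fin.castSucc_injective _ (le_antisymm (not_lt.mp h5) (not_lt.mp h4)))
    · rw [h.eq _ hk] at hmem
      exact hnot _ hsucc hmem
  have hoff : ∀ r s, r ≠ s → ¬ (r = i ∧ s = j) → relPos V V' r s = 0 := by
    intro r s h1 h2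
    by_contra h0
    rcases hx ⟨(r, s), ⟨0, Nat.pos_of_ne_zero h0⟩⟩ with h3 | h3
    · exact h1 h3
    · exact h2 h3
  have hC : relPos V V' =
      Matrix.diagonal (fun t => relPos V V' t t) + Matrix.single i j (relPos V V' i j) := by
    ext r s
    rw [Matrix.add_apply, Matrix.single_apply]
    by_cases hrs : r = s
    · subst hrs
      rw [Matrix.diagonal_apply_eq, if_neg fun hh => hij.ne (hh.1.trans hh.2.symm), add_zero]
    · rw [Matrix.diagonal_apply_ne _ hrs, zero_add]
      split_ifs with h1
      · rw [h1.1, h1.2]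
      · exact hoff r s hrs fun hh => h1 ⟨hh.1.symm, hh.2.symm⟩
  have h1 := (isElementary_of_relPos hij hC).dim
  have h2 := h.dim
  have h3 : relPos V V' i j = a := by omega
  rwa [h3] at hC

theorem isElementary_zero_iff {i j : Fin n} {V V' : Flag K n d} :
    IsElementary i j 0 V V' ↔ V = V' := by
  constructor
  · intro h
    have h1 : V'.space i.succ = V.space i.succ :=
      Submodule.eq_of_le_of_finrank_eq (h.le _) (by rw [h.dim, add_zero])
    refine Flag.ext (funext fun k => ?_)
    by_cases hk : i.castSucc < k ∧ k ≤ j.castSucc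
    · refine le_antisymm ((h.le_sup k hk.1 hk.2).trans (sup_le le_rfl ?_)) (h.le k)
      rw [← h1]
      exact V'.mono (Fin.castSucc_lt_iff_succ_le.mp hk.1)
    · exact h.eq k hk
  · rintro rfl
    exact ⟨fun _ => le_rfl, fun _ _ => rfl, fun _ _ _ => le_sup_left, inf_le_left, rfl⟩

/-- This drives the induction on $a$. Read for fixed $V$ and $V'$, it says that the vectors reducing
a step of size $a+1$ to one of size $a$ are those of $V_{i+1}$ outside $V'_{i+1}$, so their number
depends only on $a$ and $\dim V'_{i+1}$. -/
theorem isElementary_addVec_iff {i j : Fin n} (hij : i < j) {a : ℕ} {V V' : Flag K n d}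
    {y : Fin d → K} :
    (y ∈ V'.space j.succ ∧ y ∉ V'.space j.castSucc) ∧ IsElementary i j a V (addVec V' i j y) ↔
      IsElementary i j (a + 1) V V' ∧ y ∈ V.space i.succ ∧ y ∉ V'.space i.succ := by
  have hi1 : i.castSucc < i.succ := Fin.castSucc_lt_succ
  have hi2 : i.succ ≤ j.castSucc :=
    Fin.castSucc_lt_iff_succ_le.mp (Fin.castSucc_lt_castSucc_iff.mpr hij)
  have hi3 : i.castSucc < j.castSucc := hi1.trans_le hi2
  have hjs : ¬ (i.castSucc < j.succ ∧ j.succ ≤ j.castSucc) := fun h =>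
    h.2.not_gt Fin.castSucc_lt_succ
  constructor
  · rintro ⟨⟨hy, hy'⟩, h⟩
    have hyi : y ∉ V'.space i.succ := fun hm => hy' (V'.mono hi2 hm)
    have hsp := @addVec_space_of_mem K _ n d V' i j y hy
    have hle : ∀ k, V'.space k ≤ (addVec V' i j y).space k := by
      intro k
      by_cases hk : i.castSucc < k ∧ k ≤ j.castSucc
      · rw [hsp hk.1 hk.2]
        exact le_sup_left
      · rw [addVec_space_of_not hk]
    have hyV : y ∈ V.space i.succ := by
      refine h.le _ ?_
      rw [hsp hi1 hi2]
      exact Submodule.mem_sup_right (Submodule.mem_span_singleton_self y)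
    have hspan : Submodule.span K {y} ≤ V.space i.succ :=
      Submodule.span_le.mpr (Set.singleton_subset_iff.mpr hyV)
    refine ⟨⟨fun k => (hle k).trans (h.le k), fun k hk => ?_, fun k h1 h2 => ?_, ?_, ?_⟩, hyV, hyi⟩
    · rw [h.eq k hk, addVec_space_of_not hk]
    · refine (h.le_sup k h1 h2).trans (sup_le ?_ le_sup_right)
      rw [hsp h1 h2]
      exact sup_le_sup le_rfl hspan
    · rintro v ⟨hv1, hv2⟩
      have h3 := h.inf_le ⟨hv1, hle _ hv2⟩
      rw [hsp hi1 hi2] at h3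
      obtain ⟨u, hu, z, hz, rfl⟩ := Submodule.mem_sup.mp h3
      obtain ⟨c, rfl⟩ := Submodule.mem_span_singleton.mp hz
      by_cases hc : c = 0
      · simpa [hc] using hu
      -- A nonzero coefficient of $y$ would put $y$ into $V'_j$.
      · exfalso
        have h4 := (Submodule.add_mem_iff_right _ (V'.mono hi2 hu)).mp hv2
        exact hy' ((Submodule.smul_mem_iff _ hc).mp h4)
    · rw [h.dim, hsp hi1 hi2, finrank_sup_span_singleton hyi]
      omega
  · rintro ⟨h, hyV, hyi⟩
    have hy : y ∈ V'.space j.succ := by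
      rw [← h.eq _ hjs]
      exact V.mono (hi2.trans Fin.castSucc_lt_succ.le) hyV
    have hy' : y ∉ V'.space j.castSucc := fun hm => hyi (h.inf_le ⟨hyV, hm⟩)
    have hsp := @addVec_space_of_mem K _ n d V' i j y hy
    have hspan : Submodule.span K {y} ≤ V.space i.succ :=
      Submodule.span_le.mpr (Set.singleton_subset_iff.mpr hyV)
    refine ⟨⟨hy, hy'⟩, fun k => ?_, fun k hk => ?_, fun k h1 h2 => ?_, ?_, ?_⟩
    · by_cases hk : i.castSucc < k ∧ k ≤ j.castSucc
      · rw [hsp hk.1 hk.2]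
        exact sup_le (h.le k) (hspan.trans (V.mono (Fin.castSucc_lt_iff_succ_le.mp hk.1)))
      · rw [addVec_space_of_not hk]
        exact h.le k
    · rw [addVec_space_of_not hk, h.eq k hk]
    · rw [hsp h1 h2]
      exact (h.le_sup k h1 h2).trans (sup_le_sup le_sup_left le_rfl)
    -- Modular law, as $Ky\le V_{i+1}$: the intersection is $(V_{i+1}\cap V'_j)+Ky$.
    · rw [hsp hi3 le_rfl, hsp hi1 hi2, sup_comm, inf_comm, sup_inf_assoc_of_le _ hspan, sup_comm,
        inf_comm]
      exact sup_le_sup h.inf_le le_rfl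
    · rw [hsp hi1 hi2, finrank_sup_span_singleton hyi, h.dim]
      omega

open Classical in
theorem card_mem_not_mem [Fintype K] {S R : Submodule K (Fin d → K)} (h : R ≤ S) :
    ((Finset.univ.filter fun y => y ∈ S ∧ y ∉ R).card : ℝ) =
      (Fintype.card K : ℝ) ^ finrank K S - (Fintype.card K : ℝ) ^ finrank K R := by
  have hc : ∀ W : Submodule K (Fin d → K),
      (Finset.univ.filter fun y => y ∈ W).card = Fintype.card K ^ finrank K W := by
    intro W
    rw [← Fintype.card_subtype]
    exact Module.card_eq_pow_finrank (K := K) (V := W)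
  have h1 : (Finset.univ.filter fun y => y ∈ S ∧ y ∉ R) =
      (Finset.univ.filter fun y => y ∈ S) \ (Finset.univ.filter fun y => y ∈ R) := by
    ext y
    simp
  have h2 : (Finset.univ.filter fun y => y ∈ R) ⊆ (Finset.univ.filter fun y => y ∈ S) := by
    intro y
    simpa using @h y
  rw [h1, Finset.cast_card_sdiff h2, hc, hc]
  push_cast
  rfl

open Classical in
theorem sum_newVecs_isElementary [Fintype K] {i j : Fin n} (hij : i < j) (a : ℕ)
    (V V' : Flag K n d) :
    (∑ y ∈ newVecs V' j, if IsElementary i j a V (addVec V' i j y) then (1 : ℝ) else 0) =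
      (if IsElementary i j (a + 1) V V' then 1 else 0) *
        ((Fintype.card K : ℝ) ^ (finrank K (V'.space i.succ) + (a + 1)) -
          (Fintype.card K : ℝ) ^ finrank K (V'.space i.succ)) := by
  rw [Finset.sum_boole, newVecs, Finset.filter_filter]
  simp only [isElementary_addVec_iff hij]
  by_cases h : IsElementary i j (a + 1) V V'
  · simp only [h, true_and, if_true, one_mul]
    rw [card_mem_not_mem (h.le _), h.dim]
  · simp [h]

theorem exists_relPos_eq (K : Type) [Field K] {C : Matrix (Fin n) (Fin n) ℕ} (hC : C ∈ Theta n d) :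
    ∃ b : Basis (Cells C) K (Fin d → K),
      relPos (coordFlag b fun x => x.1.1) (coordFlag b fun x => x.1.2) = C := by
  have hcard : Fintype.card (Fin d) = Fintype.card (Cells C) := by
    rw [card_cells, Fintype.card_fin]
    exact hC.symm
  refine ⟨(Pi.basisFun K (Fin d)).reindex (Fintype.equivOfCardEq hcard), ?_⟩
  ext i j
  rw [relPos_of_isAdapted (isAdapted_coordFlag _ _) (isAdapted_coordFlag _ _),
    ← Fintype.card_subtype]
  refine (Fintype.card_congr ?_).trans (Fintype.card_fin (C i j))
  refine ⟨fun x => Fin.cast (by rw [x.2.1, x.2.2]) x.1.2, fun t => ⟨⟨(i, j), t⟩, rfl, rfl⟩, ?_, ?_⟩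
  · rintro ⟨⟨⟨r, s⟩, t⟩, rfl, rfl⟩
    rfl
  · intro t
    rfl

end AddVec

end BLM

end

/-! ### Polynomial dependence on q -/

noncomputable section

namespace BLM

open Module Polynomial

theorem infinite_odd_primes : {p : ℕ | p.Prime ∧ Odd p}.Infinite := by
  refine (Nat.infinite_setOfPred_prime.sdiff (Set.finite_singleton 2)).mono ?_
  rintro p ⟨hp, h2⟩
  exact ⟨hp, hp.odd_of_ne_two h2⟩

/-- Divisibility by a monic polynomial can be tested on the values at odd primes. -/
theorem dvd_of_eval_dvd {f g : ℤ[X]} (hg : g.Monic)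
    (h : ∀ p : ℕ, p.Prime → Odd p → g.eval (p : ℤ) ∣ f.eval (p : ℤ)) : g ∣ f := by
  rw [← modByMonic_eq_zero_iff_dvd hg]
  set r := f %ₘ g with hr
  have hdeg : (r.map (Int.castRingHom ℝ)).degree < (g.map (Int.castRingHom ℝ)).degree := by
    rw [hg.degree_map]
    exact degree_map_le.trans_lt (degree_modByMonic_lt f hg)
  have hlim := (div_tendsto_atTop_zero_of_degree_lt _ _ hdeg).comp
    (tendsto_natCast_atTop_atTop (R := ℝ))
  have hev := hlim.eventually (Metric.ball_mem_nhds (0 : ℝ) one_pos)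
  obtain ⟨N, hN⟩ := Filter.eventually_atTop.mp hev
  have hinf : ({p : ℕ | p.Prime ∧ Odd p} \ Set.Iio N).Infinite :=
    infinite_odd_primes.sdiff (Set.finite_Iio N)
  -- For large $p$ one has $|r(p)|<|g(p)|$ unless $g(p)=0$, while $g(p)\mid r(p)$; so $gr$ vanishes
  -- at infinitely many primes.
  have hev0 : ∀ p ∈ ({p : ℕ | p.Prime ∧ Odd p} \ Set.Iio N), g.eval (p : ℤ) = 0 ∨
      r.eval (p : ℤ) = 0 := by
    rintro p ⟨⟨hp, hodd⟩, hpN⟩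
    by_contra! hne
    have hdvd : g.eval (p : ℤ) ∣ r.eval (p : ℤ) := by
      have h1 := congrArg (eval (p : ℤ)) (modByMonic_add_div f g)
      rw [eval_add, eval_mul, ← hr] at h1
      have h2 := h p hp hodd
      rw [← h1] at h2
      exact (dvd_add_left (dvd_mul_right _ _)).mp h2
    have habs : |g.eval (p : ℤ)| ≤ |r.eval (p : ℤ)| :=
      Int.le_of_dvd (abs_pos.mpr hne.2) ((abs_dvd_abs _ _).mpr hdvd)
    have hlt := hN p (not_lt.mp hpN)
    simp only [dist_zero_right, Function.comp_apply, norm_div, Real.norm_eq_abs]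
      at hlt
    have e1 : ∀ s : ℤ[X], (s.map (Int.castRingHom ℝ)).eval (p : ℝ) = ((s.eval (p : ℤ) : ℤ) : ℝ) := by
      intro s
      simp
    rw [e1, e1, div_lt_one (abs_pos.mpr (Int.cast_ne_zero.mpr hne.1))] at hlt
    have hlt' : |r.eval (p : ℤ)| < |g.eval (p : ℤ)| := by exact_mod_cast hlt
    omega
  have hprod : g * r = 0 := by
    refine eq_of_infinite_eval_eq _ _ ((hinf.image (f := fun p : ℕ => (p : ℤ))
      Nat.cast_injective.injOn).mono ?_)
    rintro _ ⟨p, hp, rfl⟩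
    change eval _ _ = eval _ _
    rw [eval_mul, eval_zero, mul_eq_zero]
    exact hev0 p hp
  exact (mul_eq_zero.mp hprod).resolve_left hg.ne_zero

instance instFintypeField (κ : OddField) : Fintype κ.K := Fintype.ofFinite _

/-- The order of the field. -/
def OddField.q (κ : OddField) : ℕ := κ.p ^ κ.r

theorem OddField.card_K (κ : OddField) : Fintype.card κ.K = κ.q := by
  rw [← Nat.card_eq_fintype_card]
  exact GaloisField.card κ.p κ.r κ.pos

theorem OddField.one_lt_q (κ : OddField) : 1 < κ.q :=
  Nat.one_lt_pow κ.pos κ.prime.out.one_lt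

/-- The field of odd prime order `p`. -/
def OddField.ofPrime (p : ℕ) (hp : p.Prime) (hodd : Odd p) : OddField :=
  ⟨p, 1, ⟨hp⟩, hodd, one_ne_zero⟩

theorem OddField.q_ofPrime (p : ℕ) (hp : p.Prime) (hodd : Odd p) :
    (OddField.ofPrime p hp hodd).q = p :=
  pow_one p

variable {n d : ℕ}

theorem ConvFamily.mul_apply (F G : ConvFamily n d) (κ : OddField) (V V' : Flag κ.K n d) :
    (F * G) κ V V' = ∑ V'', F κ V V'' * G κ V'' V' :=
  rfl

theorem ConvFamily.ext {F G : ConvFamily n d} (h : ∀ κ V V', F κ V V' = G κ V V') : F = G :=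
  funext fun κ => Matrix.ext (h κ)

/-- The value of `F` at a pair of flags is a polynomial in `q` which depends only on the relative
position of the pair. -/
def IsPoly (F : ConvFamily n d) : Prop :=
  ∃ c : Matrix (Fin n) (Fin n) ℕ → ℤ[X], ∀ (κ : OddField) (V V' : Flag κ.K n d),
    F κ V V' = (((c (relPos V V')).eval (κ.q : ℤ) : ℤ) : ℝ)

theorem IsPoly.sum_newVecs {F : ConvFamily n d} (hF : IsPoly F) (i j : Fin n) :
    IsPoly (n := n) (d := d) fun _ => Matrix.of fun V V' =>
      ∑ y ∈ newVecs V' j, F _ V (addVec V' i j y) := by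
  classical
  obtain ⟨c, hc⟩ := hF
  refine ⟨fun C => ∑ Z : Finset (Cells C), (X - 1) ^ Z.card *
    if (∀ x ∈ Z, x.1.2.castSucc < j.succ) ∧ ¬ (∀ x ∈ Z, x.1.2.castSucc < j.castSucc) then
      c (shiftMatrix C i j Z) else 0, fun κ V V' => ?_⟩
  change ∑ y ∈ newVecs V' j, F κ V (addVec V' i j y) = _
  rw [Finset.sum_congr rfl fun y _ => hc κ V (addVec V' i j y),
    BLM.sum_newVecs V V' i j fun C => (((c C).eval (κ.q : ℤ) : ℤ) : ℝ), eval_finsetSum,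
    Int.cast_sum]
  refine Finset.sum_congr rfl fun Z _ => ?_
  rw [κ.card_K]
  split_ifs <;> simp

open Classical in
/-- The characteristic function of the union of the orbits of `D + a E_{ij}`, `D` diagonal. -/
def elemFun (n d : ℕ) (i j : Fin n) (a : ℕ) : ConvFamily n d :=
  fun _ => Matrix.of fun V V' => if IsElementary i j a V V' then 1 else 0

theorem elemFun_apply (i j : Fin n) (a : ℕ) (κ : OddField) (V V' : Flag κ.K n d)
    [Decidable (IsElementary i j a V V')] :
    elemFun n d i j a κ V V' = if IsElementary i j a V V' then 1 else 0 := by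
  simp only [elemFun, Matrix.of_apply]
  congr

theorem elemFun_zero (i j : Fin n) : elemFun n d i j 0 = 1 := by
  classical
  refine ConvFamily.ext fun κ V V' => ?_
  rw [elemFun_apply]
  change _ = (1 : Matrix (Flag κ.K n d) (Flag κ.K n d) ℝ) V V'
  rw [Matrix.one_apply]
  simp only [isElementary_zero_iff]

/-- Exchange the two sums: each middle flag contributes the same number of vectors, which factors
out. -/
theorem mul_elemFun_succ (F : ConvFamily n d) {i j : Fin n} (hij : i < j) (a : ℕ) (κ : OddField)
    (V V' : Flag κ.K n d) :
    ∑ y ∈ newVecs V' j, (F * elemFun n d i j a) κ V (addVec V' i j y) =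
      (F * elemFun n d i j (a + 1)) κ V V' *
        ((κ.q : ℝ) ^ (finrank κ.K (V'.space i.succ) + (a + 1)) -
          (κ.q : ℝ) ^ finrank κ.K (V'.space i.succ)) := by
  classical
  simp only [ConvFamily.mul_apply, elemFun_apply]
  rw [Finset.sum_comm, Finset.sum_mul]
  refine Finset.sum_congr rfl fun V'' _ => ?_
  rw [← Finset.mul_sum, sum_newVecs_isElementary hij, κ.card_K, mul_assoc]

/-- All values of `F` are integers. -/
def IsIntegerValued (F : ConvFamily n d) : Prop :=
  ∀ (κ : OddField) (V V' : Flag κ.K n d), ∃ m : ℤ, F κ V V' = m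

theorem IsPoly.isIntegerValued {F : ConvFamily n d} (hF : IsPoly F) : IsIntegerValued F := by
  obtain ⟨c, hc⟩ := hF
  exact fun κ V V' => ⟨_, hc κ V V'⟩

theorem IsIntegerValued.mul {F G : ConvFamily n d} (hF : IsIntegerValued F) (hG : IsIntegerValued G) :
    IsIntegerValued (F * G) := by
  intro κ V V'
  choose f hf using fun V'' => hF κ V V''
  choose g hg using fun V'' => hG κ V'' V'
  exact ⟨∑ V'', f V'' * g V'', by
    rw [ConvFamily.mul_apply]
    push_cast
    exact Finset.sum_congr rfl fun V'' _ => by rw [hf, hg]⟩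

theorem isIntegerValued_elemFun (i j : Fin n) (a : ℕ) : IsIntegerValued (elemFun n d i j a) := by
  classical
  intro κ V V'
  exact ⟨if IsElementary i j a V V' then 1 else 0, by rw [elemFun_apply]; push_cast; rfl⟩

/-- Division by a monic polynomial which depends on the relative position. -/
theorem IsPoly.of_mul_monic {F G : ConvFamily n d} (hG : IsPoly G) (hF : IsIntegerValued F)
    (g : Matrix (Fin n) (Fin n) ℕ → ℤ[X]) (hg : ∀ C, (g C).Monic)
    (hg0 : ∀ C (κ : OddField), (g C).eval (κ.q : ℤ) ≠ 0)
    (h : ∀ κ V V', G κ V V' = F κ V V' * (((g (relPos V V')).eval (κ.q : ℤ) : ℤ) : ℝ)) :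
    IsPoly F := by
  obtain ⟨c, hc⟩ := hG
  refine ⟨fun C => c C /ₘ g C, fun κ V V' => ?_⟩
  -- The position is realized over every prime field of odd order, where the integer value of `F` is
  -- the quotient of the two polynomial values.
  have hdvd : g (relPos V V') ∣ c (relPos V V') := by
    refine dvd_of_eval_dvd (hg _) fun p hp hodd => ?_
    obtain ⟨b, hb⟩ := exists_relPos_eq (OddField.ofPrime p hp hodd).K (relPos_mem_Theta V V')
    have h1 := h (OddField.ofPrime p hp hodd) (coordFlag b fun x => x.1.1)
      (coordFlag b fun x => x.1.2)
    obtain ⟨m, hm⟩ := hF (OddField.ofPrime p hp hodd) (coordFlag b fun x => x.1.1)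
      (coordFlag b fun x => x.1.2)
    rw [hc, hb, hm, OddField.q_ofPrime] at h1
    exact ⟨m, by rw [mul_comm]; exact_mod_cast h1⟩
  have h2 : g (relPos V V') * (c (relPos V V') /ₘ g (relPos V V')) = c (relPos V V') := by
    have h3 := modByMonic_add_div (c (relPos V V')) (g (relPos V V'))
    rwa [(modByMonic_eq_zero_iff_dvd (hg _)).mpr hdvd, zero_add] at h3
  have h4 := h κ V V'
  rw [hc, ← h2, eval_mul, Int.cast_mul, mul_comm] at h4
  exact (mul_right_cancel₀ (Int.cast_ne_zero.mpr (hg0 _ κ)) h4).symm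

theorem IsPoly.mul_elemFun {F : ConvFamily n d} (hF : IsPoly F) {i j : Fin n} (hij : i < j)
    (a : ℕ) : IsPoly (F * elemFun n d i j a) := by
  induction a with
  | zero => rwa [elemFun_zero, mul_one]
  | succ a ih =>
    refine (ih.sum_newVecs i j).of_mul_monic (hF.isIntegerValued.mul (isIntegerValued_elemFun i j (a + 1)))
      (fun C => X ^ (corner C (Fin.last n) i.succ + (a + 1)) - X ^ corner C (Fin.last n) i.succ)
      (fun C => ?_) (fun C κ => ?_) (fun κ V V' => ?_)
    · refine monic_X_pow_sub ?_
      rw [degree_X_pow]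
      exact_mod_cast (by omega)
    · simp only [eval_sub, eval_pow, eval_X]
      refine sub_ne_zero.mpr (ne_of_gt ?_)
      exact pow_lt_pow_right₀ (by exact_mod_cast κ.one_lt_q) (by omega)
    · rw [Matrix.of_apply, mul_elemFun_succ F hij, finrank_right V V']
      simp

theorem corner_last_injective {D D' : Fin n → ℕ} {i j : Fin n} {a : ℕ}
    (h : ∀ k, corner (Matrix.diagonal D + Matrix.single i j a) (Fin.last n) k =
      corner (Matrix.diagonal D' + Matrix.single i j a) (Fin.last n) k) : D = D' := by
  classical
  have h' : ∀ k : Fin (n + 1), ∑ t with t.castSucc < k, D t = ∑ t with t.castSucc < k, D' t := by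
    intro k
    have := h k
    rw [corner_diagonal_add_single, corner_diagonal_add_single] at this
    simpa [Fin.castSucc_lt_last] using this
  ext t
  have h1 := h' t.succ
  rw [sum_castSucc_lt_succ, sum_castSucc_lt_succ, h'] at h1
  omega

theorem relPos_eq_elem_iff {K : Type} [Field K] {i j : Fin n} (hij : i < j) {a : ℕ}
    {V V' : Flag K n d} {D : Fin n → ℕ} :
    relPos V V' = Matrix.diagonal D + Matrix.single i j a ↔
      IsElementary i j a V V' ∧ ∀ k, finrank K (V'.space k) =
        corner (Matrix.diagonal D + Matrix.single i j a) (Fin.last n) k := by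
  constructor
  · intro h
    exact ⟨isElementary_of_relPos hij h, fun k => by rw [← h, ← finrank_right]⟩
  · rintro ⟨h1, h2⟩
    have h3 := exists_relPos_of_isElementary hij h1
    have h4 : (fun t => relPos V V' t t) = D :=
      corner_last_injective (i := i) (j := j) (a := a) fun k => by
        rw [← h2, ← h3, ← finrank_right]
    rwa [h4] at h3

theorem orbitFun_apply (M : Matrix (Fin n) (Fin n) ℕ) (κ : OddField) (V V' : Flag κ.K n d)
    [Decidable (relPos V V' = M)] :
    orbitFun n d M κ V V' = if relPos V V' = M then 1 else 0 := by
  simp only [orbitFun, Matrix.of_apply]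
  congr

/-- Among the elementary positions with given $(i,j)$ and $a$, a single orbit is singled out by the
dimensions of $V'$. These are column sums of the position of $(V,V')$, so the restriction preserves
polynomiality. -/
theorem IsPoly.mul_orbitFun {F : ConvFamily n d} (hF : IsPoly F) {i j : Fin n} (hij : i < j)
    (D : Fin n → ℕ) (a : ℕ) :
    IsPoly (F * orbitFun n d (Matrix.diagonal D + Matrix.single i j a)) := by
  classical
  obtain ⟨c, hc⟩ := hF.mul_elemFun hij a
  refine ⟨fun C => if ∀ k, corner C (Fin.last n) k =
    corner (Matrix.diagonal D + Matrix.single i j a) (Fin.last n) k then c C else 0,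
    fun κ V V' => ?_⟩
  have h1 : (F * orbitFun n d (Matrix.diagonal D + Matrix.single i j a)) κ V V' =
      if ∀ k, corner (relPos V V') (Fin.last n) k =
        corner (Matrix.diagonal D + Matrix.single i j a) (Fin.last n) k then
        (F * elemFun n d i j a) κ V V' else 0 := by
    simp only [ConvFamily.mul_apply, orbitFun_apply, elemFun_apply, relPos_eq_elem_iff hij,
      finrank_right V V']
    split_ifs with h <;> simp [h]
  rw [h1, hc]
  dsimp only
  split_ifs <;> simp

/-- The transpose of a family of matrices. -/
def ConvFamily.transpose (F : ConvFamily n d) : ConvFamily n d := fun κ => (F κ).transpose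

theorem ConvFamily.transpose_mul (F G : ConvFamily n d) :
    (F * G).transpose = G.transpose * F.transpose :=
  funext fun κ => Matrix.transpose_mul (F κ) (G κ)

theorem orbitFun_transpose (M : Matrix (Fin n) (Fin n) ℕ) :
    (orbitFun n d M).transpose = orbitFun n d M.transpose := by
  classical
  refine ConvFamily.ext fun κ V V' => ?_
  change orbitFun n d M κ V' V = _
  rw [orbitFun_apply, orbitFun_apply, relPos_swap V' V]
  simp only [Matrix.transpose_inj]

theorem IsPoly.transpose {F : ConvFamily n d} (hF : IsPoly F) : IsPoly F.transpose := by
  obtain ⟨c, hc⟩ := hF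
  refine ⟨fun C => c C.transpose, fun κ V V' => ?_⟩
  change F κ V' V = _
  rw [hc, relPos_swap V V']

theorem IsPoly.orbitFun_mul {F : ConvFamily n d} (hF : IsPoly F) {i j : Fin n} (hij : j < i)
    (D : Fin n → ℕ) (a : ℕ) :
    IsPoly (orbitFun n d (Matrix.diagonal D + Matrix.single i j a) * F) := by
  have h := (hF.transpose.mul_orbitFun hij D a).transpose
  rw [ConvFamily.transpose_mul, orbitFun_transpose, Matrix.transpose_add,
    Matrix.diagonal_transpose, Matrix.transpose_single] at h
  exact h

/-- In a common adapted basis two flags coincide exactly when each unit has equal labels, so the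
identity is supported on the diagonal positions. -/
theorem isPoly_one : IsPoly (1 : ConvFamily n d) := by
  classical
  refine ⟨fun C => if ∀ i j, i ≠ j → C i j = 0 then 1 else 0, fun κ V V' => ?_⟩
  change (1 : Matrix (Flag κ.K n d) (Flag κ.K n d) ℝ) V V' = _
  have h : V = V' ↔ ∀ i j, i ≠ j → relPos V V' i j = 0 := by
    obtain ⟨b, hV, hV'⟩ := exists_adapted_basis V V'
    constructor
    · intro hVV' i j hij
      have hs : ∀ k, V.space k = V'.space k := fun k => by rw [hVV']
      by_contra h0
      let x : Cells (relPos V V') := ⟨(i, j), ⟨0, Nat.pos_of_ne_zero h0⟩⟩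
      have h1 : ∀ k, i.castSucc < k ↔ j.castSucc < k := fun k => by
        rw [← basis_mem_iff_of_isAdapted hV k x, ← basis_mem_iff_of_isAdapted hV' k x, hs k]
      have h2 := h1 i.castSucc
      have h3 := h1 j.castSucc
      simp only [lt_irrefl, false_iff, iff_false, not_lt, Fin.castSucc_le_castSucc_iff] at h2 h3
      exact hij (le_antisymm h2 h3)
    · intro h0
      have hx : ∀ x : Cells (relPos V V'), x.1.1 = x.1.2 := fun x => by
        by_contra hne
        exact absurd x.2.2 (by simp [h0 _ _ hne])
      refine Flag.ext (funext fun k => Submodule.ext fun v => ?_)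
      rw [hV, hV']
      simp only [hx]
  rw [Matrix.one_apply]
  simp only [h]
  split_ifs <;> simp

end BLM

end

/-! ### Chains of flags and the order ≼ -/

noncomputable section

namespace BLM

open Module

variable {n d : ℕ}

section Chains

/-- Flags `V = V⁰, V¹, …, Vᴺ = V'` whose successive relative positions are the matrices
`D_p + a_p E_p`, for `p` in the list. -/
def IsChain {K : Type} [Field K] (A : Matrix (Fin n) (Fin n) ℕ) (D : OffDiag n → Fin n → ℕ) :
    List (OffDiag n) → Flag K n d → Flag K n d → Prop
  | [], V, V' => V = V'
  | p :: l, V, V' => ∃ W, relPos V W = elemMatrix A (D p) p ∧ IsChain A D l W V'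

variable {K : Type} [Field K] {A : Matrix (Fin n) (Fin n) ℕ} {D D' : OffDiag n → Fin n → ℕ}

theorem isChain_append {l l' : List (OffDiag n)} {V V' : Flag K n d} :
    IsChain A D (l ++ l') V V' ↔ ∃ W, IsChain A D l V W ∧ IsChain A D l' W V' := by
  induction l generalizing V with
  | nil => simp [IsChain]
  | cons p l ih =>
    simp only [List.cons_append, IsChain, ih]
    constructor
    · rintro ⟨U, h1, W, h2, h3⟩
      exact ⟨W, ⟨U, h1, h2⟩, h3⟩
    · rintro ⟨W, ⟨U, h1, h2⟩, h3⟩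
      exact ⟨U, h1, W, h2, h3⟩

theorem IsChain.congr {l : List (OffDiag n)} {V V' : Flag K n d} (h : IsChain A D l V V')
    (hD : ∀ p ∈ l, D p = D' p) : IsChain A D' l V V' := by
  induction l generalizing V with
  | nil => exact h
  | cons p l ih =>
    obtain ⟨W, h1, h2⟩ := h
    exact ⟨W, by rw [← hD p List.mem_cons_self, h1],
      ih h2 fun p hp => hD p (List.mem_cons_of_mem _ hp)⟩

theorem finrank_of_relPos_elem {i j : Fin n} (hij : i < j) {a : ℕ} {E : Fin n → ℕ}
    {V V' : Flag K n d} (h : relPos V V' = Matrix.diagonal E + Matrix.single i j a)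
    (k : Fin (n + 1)) : finrank K (V.space k) =
      finrank K (V'.space k) + if i.castSucc < k ∧ k ≤ j.castSucc then a else 0 := by
  rw [finrank_left V V', finrank_right V V', h, corner_diagonal_add_single,
    corner_diagonal_add_single]
  simp only [Fin.castSucc_lt_last, and_true, true_and, add_assoc]
  congr 1
  have : i.castSucc < j.castSucc := Fin.castSucc_lt_castSucc_iff.mpr hij
  by_cases h1 : i.castSucc < k
  · by_cases h2 : j.castSucc < k
    · simp [h1, h2]
    · simp [h1, h2, not_lt.mp h2]
  · have h2 : ¬ j.castSucc < k := fun h2 => h1 (this.trans h2)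
    simp [h1, h2]

theorem relPos_swap_elem {p : OffDiag n} {E : Fin n → ℕ} {V V' : Flag K n d}
    (h : relPos V V' = elemMatrix A E p) :
    relPos V' V = Matrix.diagonal E + Matrix.single p.1.2 p.1.1 (A p.1.1 p.1.2) := by
  rw [relPos_swap V V', h, elemMatrix, Matrix.transpose_add, Matrix.diagonal_transpose,
    Matrix.transpose_single]

theorem IsChain.le_of_lower {l : List (OffDiag n)} (hl : ∀ p ∈ l, p.1.2 < p.1.1)
    {V V' : Flag K n d} (h : IsChain A D l V V') (k : Fin (n + 1)) : V.space k ≤ V'.space k := by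
  induction l generalizing V with
  | nil => exact (congrArg (fun U : Flag K n d => U.space k) h).le
  | cons p l ih =>
    obtain ⟨W, h1, h2⟩ := h
    exact ((isElementary_of_relPos (hl p List.mem_cons_self) (relPos_swap_elem h1)).le k).trans
      (ih (fun p hp => hl p (List.mem_cons_of_mem _ hp)) h2)

theorem IsChain.le_of_upper {l : List (OffDiag n)} (hl : ∀ p ∈ l, p.1.1 < p.1.2)
    {V V' : Flag K n d} (h : IsChain A D l V V') (k : Fin (n + 1)) : V'.space k ≤ V.space k := by
  induction l generalizing V with
  | nil => exact (congrArg (fun U : Flag K n d => U.space k) h).ge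
  | cons p l ih =>
    obtain ⟨W, h1, h2⟩ := h
    exact (ih (fun p hp => hl p (List.mem_cons_of_mem _ hp)) h2).trans
      ((isElementary_of_relPos (hl p List.mem_cons_self) h1).le k)

theorem IsChain.space_eq_of_upper {l : List (OffDiag n)} (hl : ∀ p ∈ l, p.1.1 < p.1.2)
    {j : Fin n} (hj : ∀ p ∈ l, p.1.2 < j)
    {V V' : Flag K n d} (h : IsChain A D l V V') :
    V.space j.castSucc = V'.space j.castSucc := by
  induction l generalizing V with
  | nil => exact congrArg (fun U : Flag K n d => U.space j.castSucc) h
  | cons p l ih =>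
    obtain ⟨W, h1, h2⟩ := h
    refine ((isElementary_of_relPos (hl p List.mem_cons_self) h1).eq _ fun hh => ?_).trans
      (ih (fun p hp => hl p (List.mem_cons_of_mem _ hp))
        (fun p hp => hj p (List.mem_cons_of_mem _ hp)) h2)
    exact hh.2.not_gt (Fin.castSucc_lt_castSucc_iff.mpr (hj p List.mem_cons_self))

theorem IsChain.space_eq_of_lower {l : List (OffDiag n)} (hl : ∀ p ∈ l, p.1.2 < p.1.1)
    {j : Fin n} (hj : ∀ p ∈ l, j < p.1.2)
    {V V' : Flag K n d} (h : IsChain A D l V V') :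
    V.space j.succ = V'.space j.succ := by
  induction l generalizing V with
  | nil => exact congrArg (fun U : Flag K n d => U.space j.succ) h
  | cons p l ih =>
    obtain ⟨W, h1, h2⟩ := h
    refine ((isElementary_of_relPos (hl p List.mem_cons_self) (relPos_swap_elem h1)).eq _
      fun hh => ?_).symm.trans (ih (fun p hp => hl p (List.mem_cons_of_mem _ hp))
        (fun p hp => hj p (List.mem_cons_of_mem _ hp)) h2)
    have h3 := hj p List.mem_cons_self
    have h4 := hh.1
    simp only [Fin.lt_def, Fin.val_castSucc, Fin.val_succ] at h3 h4
    omega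

/-- Codimension of the intersection with a fixed $W$ does not increase on passing from $U'$ to $U$,
because $U/(U\cap W)$ embeds in $U'/(U'\cap W)$. -/
theorem finrank_inf_add_le {E : Type*} [AddCommGroup E] [Module K E] [FiniteDimensional K E]
    {U U' : Submodule K E} (h : U ≤ U') (W : Submodule K E) :
    finrank K ↥(U' ⊓ W) + finrank K U ≤ finrank K ↥(U ⊓ W) + finrank K U' := by
  have h1 := Submodule.finrank_sup_add_finrank_inf_eq U (U' ⊓ W)
  rw [← inf_assoc, inf_eq_left.mpr h] at h1
  have h2 : finrank K ↥(U ⊔ U' ⊓ W) ≤ finrank K U' :=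
    Submodule.finrank_mono (sup_le h inf_le_left)
  omega

/-- The sum of `a_p` over the positions `p` of the list which lie in `S`. -/
def listWeight (A : Matrix (Fin n) (Fin n) ℕ) (S : Finset (Fin n × Fin n))
    (l : List (OffDiag n)) : ℕ :=
  (l.map fun p => if p.1 ∈ S then A p.1.1 p.1.2 else 0).sum

theorem listWeight_cons (S : Finset (Fin n × Fin n)) (p : OffDiag n) (l : List (OffDiag n)) :
    listWeight A S (p :: l) = (if p.1 ∈ S then A p.1.1 p.1.2 else 0) + listWeight A S l := by
  simp [listWeight]

theorem listWeight_le (S : Finset (Fin n × Fin n)) {l : List (OffDiag n)} (hl : l.Nodup) :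
    listWeight A S l ≤ ∑ x ∈ S, A x.1 x.2 := by
  classical
  rw [listWeight, ← List.sum_toFinset _ hl, ← Finset.sum_filter]
  rw [← Finset.sum_image (s := l.toFinset.filter fun p => p.1 ∈ S) (g := Subtype.val)
    (f := fun x : Fin n × Fin n => A x.1 x.2) Subtype.val_injective.injOn]
  refine Finset.sum_le_sum_of_subset ?_
  intro x hx
  obtain ⟨p, hp, rfl⟩ := Finset.mem_image.mp hx
  exact (Finset.mem_filter.mp hp).2

/-- Factors with column at least $j$ come first, and such a factor lowers $\dim V_{i+1}$ only when
its row is at most $i$. Once the columns are below $j$, the space $V_j\supseteq V_{i+1}$ no longer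
moves and the intersection is all of $V_{i+1}$. -/
theorem IsChain.upper_bound {l : List (OffDiag n)} (hl : ∀ p ∈ l, p.1.1 < p.1.2)
    (hs : l.Pairwise fun p p' => p'.1.2 ≤ p.1.2) {i j : Fin n} (hij : i < j)
    {V V' : Flag K n d} (h : IsChain A D l V V') :
    finrank K (V.space i.succ) ≤ meetDim V V' i.succ j.castSucc +
      listWeight A (Finset.Iic i ×ˢ Finset.Ici j) l := by
  have hle : i.succ ≤ j.castSucc :=
    Fin.castSucc_lt_iff_succ_le.mp (Fin.castSucc_lt_castSucc_iff.mpr hij)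
  induction l generalizing V with
  | nil =>
    obtain rfl : V = V' := h
    rw [meetDim, inf_eq_left.mpr (V.mono hle)]
    exact Nat.le_add_right _ _
  | cons p l ih =>
    by_cases hp : j ≤ p.1.2
    · obtain ⟨W, h1, h2⟩ := h
      have h3 := ih (fun p hp => hl p (List.mem_cons_of_mem _ hp)) (List.pairwise_cons.mp hs).2 h2
      have h4 := finrank_of_relPos_elem (hl p List.mem_cons_self) h1 i.succ
      have h5 : meetDim W V' i.succ j.castSucc ≤ meetDim V V' i.succ j.castSucc :=
        Submodule.finrank_mono (inf_le_inf
          ((isElementary_of_relPos (hl p List.mem_cons_self) h1).le _) le_rfl)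
      have h6 : (if p.1.1.castSucc < i.succ ∧ i.succ ≤ p.1.2.castSucc then A p.1.1 p.1.2 else 0) ≤
          if p.1 ∈ Finset.Iic i ×ˢ Finset.Ici j then A p.1.1 p.1.2 else 0 := by
        split_ifs with c1 c2
        · exact le_rfl
        · refine absurd ?_ c2
          rw [Finset.mem_product, Finset.mem_Iic, Finset.mem_Ici]
          refine ⟨?_, hp⟩
          have := c1.1
          simp only [Fin.lt_def, Fin.le_def, Fin.val_castSucc, Fin.val_succ] at this ⊢
          omega
        · exact Nat.zero_le _
        · exact le_rfl
      rw [listWeight_cons]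
      omega
    · have h1 := h.space_eq_of_upper (j := j) hl fun p' hp' => by
        rcases List.mem_cons.mp hp' with rfl | hp'
        · exact not_le.mp hp
        · exact ((List.pairwise_cons.mp hs).1 p' hp').trans_lt (not_le.mp hp)
      rw [meetDim, ← h1, inf_eq_left.mpr (V.mono hle)]
      exact Nat.le_add_right _ _

/-- Factors with column at most $j$ come first; one of them enlarges $V_i$, by $a_p$, only when its
row is at least $i$. Afterwards $V_{j+1}\subseteq V_i$ stays fixed and equals $V'_{j+1}$. -/
theorem IsChain.lower_bound {l : List (OffDiag n)} (hl : ∀ p ∈ l, p.1.2 < p.1.1)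
    (hs : l.Pairwise fun p p' => p.1.2 ≤ p'.1.2) {i j : Fin n} (hij : j < i)
    {V V' : Flag K n d} (h : IsChain A D l V V') :
    finrank K (V'.space j.succ) ≤ meetDim V V' i.castSucc j.succ +
      listWeight A (Finset.Ici i ×ˢ Finset.Iic j) l := by
  have hle : j.succ ≤ i.castSucc :=
    Fin.castSucc_lt_iff_succ_le.mp (Fin.castSucc_lt_castSucc_iff.mpr hij)
  induction l generalizing V with
  | nil =>
    obtain rfl : V = V' := h
    rw [meetDim, inf_eq_right.mpr (V.mono hle)]
    exact Nat.le_add_right _ _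
  | cons p l ih =>
    by_cases hp : p.1.2 ≤ j
    · obtain ⟨W, h1, h2⟩ := h
      have h3 := ih (fun p hp => hl p (List.mem_cons_of_mem _ hp)) (List.pairwise_cons.mp hs).2 h2
      have h1' := relPos_swap_elem h1
      have h4 := finrank_of_relPos_elem (hl p List.mem_cons_self) h1' i.castSucc
      have h5 : meetDim W V' i.castSucc j.succ + finrank K (V.space i.castSucc) ≤
          meetDim V V' i.castSucc j.succ + finrank K (W.space i.castSucc) :=
        finrank_inf_add_le ((isElementary_of_relPos (hl p List.mem_cons_self) h1').le _) _
      have h6 : (if p.1.2.castSucc < i.castSucc ∧ i.castSucc ≤ p.1.1.castSucc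
          then A p.1.1 p.1.2 else 0) ≤
          if p.1 ∈ Finset.Ici i ×ˢ Finset.Iic j then A p.1.1 p.1.2 else 0 := by
        split_ifs with c1 c2
        · exact le_rfl
        · refine absurd ?_ c2
          rw [Finset.mem_product, Finset.mem_Iic, Finset.mem_Ici]
          exact ⟨Fin.castSucc_le_castSucc_iff.mp c1.2, hp⟩
        · exact Nat.zero_le _
        · exact le_rfl
      rw [listWeight_cons]
      omega
    · have h1 := h.space_eq_of_lower (j := j) hl fun p' hp' => by
        rcases List.mem_cons.mp hp' with rfl | hp'
        · exact not_le.mp hp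
        · exact (not_le.mp hp).trans_le ((List.pairwise_cons.mp hs).1 p' hp')
      rw [meetDim, ← h1, inf_eq_right.mpr (V.mono hle)]
      exact Nat.le_add_right _ _

theorem sum_Iic_Ici_add_corner (C : Matrix (Fin n) (Fin n) ℕ) (i j : Fin n) :
    ∑ r ∈ Finset.Iic i, ∑ s ∈ Finset.Ici j, C r s + corner C i.succ j.castSucc =
      corner C i.succ (Fin.last n) := by
  have h1 : (Finset.univ.filter fun r : Fin n => r.castSucc < i.succ) = Finset.Iic i := by
    ext r
    simp only [Finset.mem_filter, Finset.mem_univ, true_and, Finset.mem_Iic, Fin.lt_def,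
      Fin.le_def, Fin.val_castSucc, Fin.val_succ]
    omega
  simp only [corner, h1]
  rw [← Finset.sum_add_distrib]
  refine Finset.sum_congr rfl fun r _ => ?_
  simp only [Fin.castSucc_lt_last, Finset.filter_true]
  rw [← Finset.sum_filter_add_sum_filter_not Finset.univ (fun s : Fin n => s.castSucc < j.castSucc),
    add_comm]
  congr 2
  ext s
  simp

theorem sum_Ici_Iic_add_corner (C : Matrix (Fin n) (Fin n) ℕ) (i j : Fin n) :
    ∑ r ∈ Finset.Ici i, ∑ s ∈ Finset.Iic j, C r s + corner C i.castSucc j.succ =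
      corner C (Fin.last n) j.succ := by
  have h := sum_Iic_Ici_add_corner C.transpose j i
  simp only [corner_transpose, Matrix.transpose_apply] at h
  rwa [Finset.sum_comm] at h

/-- Each half of the chain is bounded by its own lemma, relative to the middle flag $W$. The other
half only shrinks the space whose codimension is measured (`finrank_inf_add_le`). Only the order of
the columns is needed. -/
theorem preceq_of_isChain {l l' : List (OffDiag n)} (hl : ∀ p ∈ l, p.1.2 < p.1.1)
    (hl' : ∀ p ∈ l', p.1.1 < p.1.2) (hs : l.Pairwise fun p p' => p.1.2 ≤ p'.1.2)
    (hs' : l'.Pairwise fun p p' => p'.1.2 ≤ p.1.2) (hn : l.Nodup) (hn' : l'.Nodup)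
    {V V' : Flag K n d} (h : IsChain A D (l ++ l') V V') : Preceq (relPos V V') A := by
  obtain ⟨W, h1, h2⟩ := isChain_append.mp h
  constructor
  · intro i j hij
    have e1 := sum_Iic_Ici_add_corner (relPos V V') i j
    have e2 := h2.upper_bound hl' hs' hij
    have e3 := listWeight_le (A := A) (Finset.Iic i ×ˢ Finset.Ici j) hn'
    rw [Finset.sum_product] at e3
    dsimp only at e3
    have e4 := finrank_inf_add_le (h1.le_of_lower hl i.succ) (V'.space j.castSucc)
    rw [← finrank_left, ← meetDim_eq_corner] at e1
    simp only [meetDim] at e1 e2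
    omega
  · intro i j hij
    have e1 := sum_Ici_Iic_add_corner (relPos V V') i j
    have e2 := h1.lower_bound hl hs hij
    have e3 := listWeight_le (A := A) (Finset.Ici i ×ˢ Finset.Iic j) hn
    rw [Finset.sum_product] at e3
    dsimp only at e3
    have e4 := finrank_inf_add_le (h2.le_of_upper hl' j.succ) (V.space i.castSucc)
    rw [← finrank_right, ← meetDim_eq_corner] at e1
    simp only [meetDim] at e1 e2
    rw [inf_comm (W.space _), inf_comm (V'.space _)] at e4
    omega

/-- A matrix is determined by its row sums and its class for the preorder `≼`. -/
theorem eq_of_preceq_preceq {B C : Matrix (Fin n) (Fin n) ℕ} (h1 : Preceq B C) (h2 : Preceq C B)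
    (hrow : ∀ k, corner B k (Fin.last n) = corner C k (Fin.last n)) : B = C := by
  have hupper : ∀ i j : Fin n, i < j →
      corner B i.succ j.castSucc = corner C i.succ j.castSucc := by
    intro i j hij
    have e1 := sum_Iic_Ici_add_corner B i j
    have e2 := sum_Iic_Ici_add_corner C i j
    have e3 := h1.1 i j hij
    have e4 := h2.1 i j hij
    rw [hrow] at e1
    omega
  have hlower : ∀ i j : Fin n, j < i →
      corner B (Fin.last n) j.succ + corner C i.castSucc j.succ =
        corner C (Fin.last n) j.succ + corner B i.castSucc j.succ := by
    intro i j hij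
    have e1 := sum_Ici_Iic_add_corner B i j
    have e2 := sum_Ici_Iic_add_corner C i j
    have e3 := h1.2 i j hij
    have e4 := h2.2 i j hij
    omega
  have hcol : ∀ l, corner B (Fin.last n) l = corner C (Fin.last n) l := by
    intro l
    induction l using Fin.lastCases with
    | last => exact hrow _
    | cast i =>
      obtain h0 | ⟨j, hj⟩ := Fin.eq_zero_or_eq_succ i.castSucc
      · rw [h0, corner_zero_right, corner_zero_right]
      · have hji : j < i := by
          have := congrArg Fin.val hj
          simp only [Fin.val_castSucc, Fin.val_succ] at this
          rw [Fin.lt_def]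
          omega
        have e1 := hupper j i hji
        have e2 := hlower i j hji
        rw [hj] at e1 e2 ⊢
        omega
  refine corner_injective fun k l => ?_
  obtain rfl | ⟨i, rfl⟩ := Fin.eq_zero_or_eq_succ k
  · rw [corner_zero_left, corner_zero_left]
  obtain rfl | ⟨j, rfl⟩ := Fin.eq_zero_or_eq_succ l
  · rw [corner_zero_right, corner_zero_right]
  obtain ⟨i', hi⟩ | h := Fin.eq_castSucc_or_eq_last i.succ
  swap
  · rw [h, hcol]
  obtain ⟨j', hj⟩ | h := Fin.eq_castSucc_or_eq_last j.succ
  swap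
  · rw [h, hrow]
  have hi' := congrArg Fin.val hi
  have hj' := congrArg Fin.val hj
  simp only [Fin.val_castSucc, Fin.val_succ] at hi' hj'
  by_cases hij : i < j'
  · rw [hj, hupper i j' hij]
  · have hji : j < i' := by
      rw [Fin.lt_def] at hij ⊢
      omega
    have := hlower i' j hji
    rw [hcol, ← hi] at this
    omega

theorem IsChain.eq_of_finrank_eq {K' : Type} [Field K'] {l : List (OffDiag n)}
    {V V' : Flag K n d} {U U' : Flag K' n d}
    (h : IsChain A D l V V') (h' : IsChain A D' l U U')
    (hdim : ∀ k, finrank K (V.space k) = finrank K' (U.space k)) : ∀ p ∈ l, D p = D' p := by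
  induction l generalizing V U with
  | nil => simp
  | cons p l ih =>
    obtain ⟨W, h1, h2⟩ := h
    obtain ⟨W', h1', h2'⟩ := h'
    have hp : D p = D' p := by
      refine corner_last_injective (i := p.1.2) (j := p.1.1) (a := A p.1.1 p.1.2) fun k => ?_
      rw [← relPos_swap_elem h1, ← relPos_swap_elem h1', ← finrank_right, ← finrank_right, hdim]
    have h3 := ih h2 h2' fun k => by
      rw [finrank_right V W, finrank_right U W', h1, h1', hp]
    intro p' hp'
    rcases List.mem_cons.mp hp' with rfl | hp'
    · exact hp
    · exact h3 p' hp'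

end Chains

end BLM

end

/-! ### The order of the factors -/

noncomputable section

namespace BLM

open Module

variable {n d : ℕ}

section Lists

theorem mem_lowerList {p : OffDiag n} : p ∈ lowerList n ↔ p.1.2 < p.1.1 := by
  simp only [lowerList, List.mem_flatMap, List.mem_finRange, true_and, List.mem_filterMap]
  constructor
  · rintro ⟨j, i, h⟩
    split_ifs at h with hij
    obtain rfl := Option.some_injective _ h
    exact hij
  · exact fun h => ⟨p.1.2, p.1.1, dif_pos h⟩

theorem mem_upperList {p : OffDiag n} : p ∈ upperList n ↔ p.1.1 < p.1.2 := by
  simp only [upperList, List.mem_flatMap, List.mem_reverse, List.mem_finRange, true_and,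
    List.mem_filterMap]
  constructor
  · rintro ⟨j, i, h⟩
    split_ifs at h with hij
    obtain rfl := Option.some_injective _ h
    exact hij
  · exact fun h => ⟨p.1.2, p.1.1, dif_pos h⟩

theorem lowerList_pairwise : (lowerList n).Pairwise fun p p' =>
    p.1.2 < p'.1.2 ∨ p.1.2 = p'.1.2 ∧ p.1.1 < p'.1.1 := by
  rw [lowerList, List.pairwise_flatMap]
  constructor
  · intro j _
    rw [List.pairwise_filterMap]
    refine (List.pairwise_lt_finRange n).imp fun {i i'} hii' b hb b' hb' => ?_
    split_ifs at hb hb'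
    obtain rfl := Option.some_injective _ hb
    obtain rfl := Option.some_injective _ hb'
    exact Or.inr ⟨rfl, hii'⟩
  · refine (List.pairwise_lt_finRange n).imp fun {j j'} hjj' x hx y hy => ?_
    obtain ⟨i, -, hx⟩ := List.mem_filterMap.mp hx
    obtain ⟨i', -, hy⟩ := List.mem_filterMap.mp hy
    split_ifs at hx hy
    obtain rfl := Option.some_injective _ hx
    obtain rfl := Option.some_injective _ hy
    exact Or.inl hjj'

theorem upperList_pairwise : (upperList n).Pairwise fun p p' =>
    p'.1.2 < p.1.2 ∨ p.1.2 = p'.1.2 ∧ p'.1.1 < p.1.1 := by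
  rw [upperList, List.pairwise_flatMap]
  constructor
  · intro j _
    rw [List.pairwise_filterMap]
    refine (List.pairwise_reverse.mpr (List.pairwise_lt_finRange n)).imp
      fun {i i'} hii' b hb b' hb' => ?_
    split_ifs at hb hb'
    obtain rfl := Option.some_injective _ hb
    obtain rfl := Option.some_injective _ hb'
    exact Or.inr ⟨rfl, hii'⟩
  · refine (List.pairwise_reverse.mpr (List.pairwise_lt_finRange n)).imp
      fun {j j'} hjj' x hx y hy => ?_
    obtain ⟨i, -, hx⟩ := List.mem_filterMap.mp hx
    obtain ⟨i', -, hy⟩ := List.mem_filterMap.mp hy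
    split_ifs at hx hy
    obtain rfl := Option.some_injective _ hx
    obtain rfl := Option.some_injective _ hy
    exact Or.inl hjj'

theorem lowerList_sorted : (lowerList n).Pairwise fun p p' => p.1.2 ≤ p'.1.2 :=
  lowerList_pairwise.imp fun h => h.elim le_of_lt fun h => h.1.le

theorem upperList_sorted : (upperList n).Pairwise fun p p' => p'.1.2 ≤ p.1.2 :=
  upperList_pairwise.imp fun h => h.elim le_of_lt fun h => h.1.ge

theorem lowerList_nodup : (lowerList n).Nodup :=
  lowerList_pairwise.imp fun h => by
    rintro rfl
    exact h.elim (lt_irrefl _) fun h => lt_irrefl _ h.2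

theorem upperList_nodup : (upperList n).Nodup :=
  upperList_pairwise.imp fun h => by
    rintro rfl
    exact h.elim (lt_irrefl _) fun h => lt_irrefl _ h.2

theorem mem_lowerList_append_upperList (p : OffDiag n) : p ∈ lowerList n ++ upperList n := by
  rw [List.mem_append, mem_lowerList, mem_upperList]
  exact lt_or_gt_of_ne p.2.symm

theorem lowerList_append_upperList_nodup : (lowerList n ++ upperList n).Nodup :=
  List.Nodup.append lowerList_nodup upperList_nodup fun _ h h' =>
    lt_asymm (mem_lowerList.mp h) (mem_upperList.mp h')

end Lists

/-! ### Construction of a chain by relabelling -/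

section Labels

variable {A : Matrix (Fin n) (Fin n) ℕ}

open Classical in
/-- The label of a unit of `A` after the positions in `S` have been moved from their row label to
their column label. -/
def label (S : Set (Fin n × Fin n)) (x : Cells A) : Fin n :=
  if x.1 ∈ S then x.1.2 else x.1.1

theorem card_cells_at (p : Fin n × Fin n) :
    (Finset.univ.filter fun x : Cells A => x.1 = p).card = A p.1 p.2 := by
  classical
  rw [← Fintype.card_subtype]
  refine (Fintype.card_congr ?_).trans (Fintype.card_fin (A p.1 p.2))
  refine ⟨fun x => Fin.cast (by rw [x.2]) x.1.2, fun t => ⟨⟨p, t⟩, rfl⟩, ?_, ?_⟩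
  · rintro ⟨⟨p, t⟩, rfl⟩
    rfl
  · intro t
    rfl

open Classical in
theorem relPos_label {K : Type} [Field K] (b : Basis (Cells A) K (Fin d → K))
    {S : Set (Fin n × Fin n)} {p : OffDiag n} (hp : p.1 ∉ S) :
    relPos (coordFlag b (label S)) (coordFlag b (label (insert p.1 S))) =
      elemMatrix A
        (fun t => (Finset.univ.filter fun x : Cells A => x.1 ≠ p.1 ∧ label S x = t).card) p := by
  ext i j
  rw [relPos_of_isAdapted (isAdapted_coordFlag _ _) (isAdapted_coordFlag _ _),
    ← Finset.card_filter_add_card_filter_not (fun x : Cells A => x.1 ≠ p.1),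
    Finset.filter_filter, Finset.filter_filter, elemMatrix, Matrix.add_apply]
  have hne : ∀ x : Cells A, x.1 ≠ p.1 → label (insert p.1 S) x = label S x := by
    intro x hx
    simp [label, hx]
  have heq : ∀ x : Cells A, x.1 = p.1 → label S x = p.1.1 ∧ label (insert p.1 S) x = p.1.2 := by
    intro x hx
    simp [label, hx, hp]
  congr 1
  · rw [Matrix.diagonal_apply]
    split_ifs with hij
    · subst hij
      congr 1
      refine Finset.filter_congr fun x _ => ?_
      constructor
      · exact fun h => ⟨h.2, h.1.1⟩
      · exact fun h => ⟨⟨h.2, by rw [hne x h.1, h.2]⟩, h.1⟩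
    · rw [Finset.card_eq_zero, Finset.filter_eq_empty_iff]
      rintro x - ⟨⟨h1, h2⟩, h3⟩
      rw [hne x h3] at h2
      exact hij (h1.symm.trans h2)
  · rw [Matrix.single_apply]
    split_ifs with hij
    · rw [← card_cells_at (A := A) p.1]
      congr 1
      refine Finset.filter_congr fun x _ => ?_
      constructor
      · exact fun h => not_not.mp h.2
      · intro h
        exact ⟨⟨(heq x h).1.trans hij.1, (heq x h).2.trans hij.2⟩, not_not.mpr h⟩
    · rw [Finset.card_eq_zero, Finset.filter_eq_empty_iff]
      rintro x - ⟨⟨h1, h2⟩, h3⟩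
      have h4 := heq x (not_not.mp h3)
      exact hij ⟨h4.1.symm.trans h1, h4.2.symm.trans h2⟩

/-- `S` records the positions already moved. The matrices `D p` are counts of labels, which involve
no field; the same family therefore serves for all fields. -/
theorem exists_isChain_label (hA : A ∈ Theta n d) {l : List (OffDiag n)} (hl : l.Nodup)
    (S : Set (Fin n × Fin n)) (hS : ∀ p ∈ l, p.1 ∉ S) :
    ∃ D : OffDiag n → Fin n → ℕ, (∀ p ∈ l, elemMatrix A (D p) p ∈ Theta n d) ∧
      ∀ (K : Type) [Field K] (b : Basis (Cells A) K (Fin d → K)),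
        IsChain A D l (coordFlag b (label S))
          (coordFlag b (label (S ∪ {x | ∃ p ∈ l, p.1 = x}))) := by
  classical
  induction l generalizing S with
  | nil => exact ⟨0, by simp, fun K _ b => by simp [IsChain]⟩
  | cons p l ih =>
    rw [List.nodup_cons] at hl
    obtain ⟨D, hD1, hD2⟩ := ih hl.2 (insert p.1 S) fun p' hp' => by
      rw [Set.mem_insert_iff, not_or]
      refine ⟨fun h => hl.1 (Subtype.ext h ▸ hp'), hS p' (List.mem_cons_of_mem _ hp')⟩
    have hset : S ∪ {x | ∃ p' ∈ p :: l, p'.1 = x} =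
        insert p.1 S ∪ {x | ∃ p' ∈ l, p'.1 = x} := by
      ext x
      simp only [Set.mem_union, Set.mem_ofPred_eq, List.mem_cons, Set.mem_insert_iff,
        exists_eq_or_imp, eq_comm (a := x)]
      tauto
    have hpS := hS p List.mem_cons_self
    have hupd : ∀ p' ∈ l, ∀ E, D p' = Function.update D p E p' := fun p' hp' E => by
      rw [Function.update_of_ne]
      rintro rfl
      exact hl.1 hp'
    refine ⟨Function.update D p fun t =>
      (Finset.univ.filter fun x : Cells A => x.1 ≠ p.1 ∧ label S x = t).card, ?_, ?_⟩
    · intro p' hp'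
      rcases List.mem_cons.mp hp' with rfl | hp'
      -- Any field would do: the sum of the entries is read off from a realization by flags.
      · obtain ⟨b, -⟩ := exists_relPos_eq ℚ hA
        rw [Function.update_self, ← relPos_label b hpS]
        exact relPos_mem_Theta _ _
      · rw [← hupd p' hp']
        exact hD1 p' hp'
    · intro K _ b
      rw [hset]
      refine ⟨_, ?_, (hD2 K b).congr fun p' hp' => hupd p' hp' _⟩
      rw [Function.update_self]
      exact relPos_label b hpS

end Labels

/-! ### Products as counts of chains -/

section Products

variable (A : Matrix (Fin n) (Fin n) ℕ) (D : OffDiag n → Fin n → ℕ)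

/-- The product of the characteristic functions of the orbits of `D_p + a_p E_p`. -/
def orbitProd (d : ℕ) (l : List (OffDiag n)) : ConvFamily n d :=
  (l.map fun p => orbitFun n d (elemMatrix A (D p) p)).prod

theorem orbitProd_cons (p : OffDiag n) (l : List (OffDiag n)) :
    orbitProd A D d (p :: l) = orbitFun n d (elemMatrix A (D p) p) * orbitProd A D d l := by
  rw [orbitProd, List.map_cons, List.prod_cons, orbitProd]

theorem orbitProd_append (l l' : List (OffDiag n)) :
    orbitProd A D d (l ++ l') = orbitProd A D d l * orbitProd A D d l' := by
  rw [orbitProd, List.map_append, List.prod_append, orbitProd, orbitProd]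

/-- Nonnegativity is carried through the induction, since it is what prevents cancellation in the
sum over middle flags. -/
theorem orbitProd_nonneg_and_ne_zero_iff (l : List (OffDiag n)) (κ : OddField)
    (V V' : Flag κ.K n d) :
    0 ≤ orbitProd A D d l κ V V' ∧ (orbitProd A D d l κ V V' ≠ 0 ↔ IsChain A D l V V') := by
  classical
  induction l generalizing V with
  | nil =>
    change 0 ≤ (1 : Matrix (Flag κ.K n d) (Flag κ.K n d) ℝ) V V' ∧
      ((1 : Matrix (Flag κ.K n d) (Flag κ.K n d) ℝ) V V' ≠ 0 ↔ V = V')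
    rw [Matrix.one_apply]
    split_ifs with h <;> simp [h]
  | cons p l ih =>
    rw [orbitProd_cons, ConvFamily.mul_apply]
    have hnn : ∀ W ∈ Finset.univ, 0 ≤ orbitFun n d (elemMatrix A (D p) p) κ V W *
        orbitProd A D d l κ W V' := by
      intro W _
      refine mul_nonneg ?_ (ih W).1
      rw [orbitFun_apply]
      split_ifs <;> norm_num
    refine ⟨Finset.sum_nonneg hnn, ?_⟩
    rw [ne_eq, Finset.sum_eq_zero_iff_of_nonneg hnn, IsChain]
    push Not
    refine exists_congr fun W => ?_
    rw [mul_ne_zero_iff, (ih W).2, orbitFun_apply]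
    simp

theorem orbitProd_ne_zero_iff {l : List (OffDiag n)} {κ : OddField} {V V' : Flag κ.K n d} :
    orbitProd A D d l κ V V' ≠ 0 ↔ IsChain A D l V V' :=
  (orbitProd_nonneg_and_ne_zero_iff A D l κ V V').2

theorem IsPoly.mul_orbitProd {F : ConvFamily n d} (hF : IsPoly F) {l : List (OffDiag n)}
    (hl : ∀ p ∈ l, p.1.1 < p.1.2) : IsPoly (F * orbitProd A D d l) := by
  induction l generalizing F with
  | nil =>
    change IsPoly (F * 1)
    rwa [mul_one]
  | cons p l ih =>
    rw [orbitProd_cons, ← mul_assoc]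
    exact ih (hF.mul_orbitFun (hl p List.mem_cons_self) _ _)
      fun p hp => hl p (List.mem_cons_of_mem _ hp)

theorem IsPoly.orbitProd_mul {F : ConvFamily n d} (hF : IsPoly F) {l : List (OffDiag n)}
    (hl : ∀ p ∈ l, p.1.2 < p.1.1) : IsPoly (orbitProd A D d l * F) := by
  induction l with
  | nil =>
    change IsPoly (1 * F)
    rwa [one_mul]
  | cons p l ih =>
    rw [orbitProd_cons, mul_assoc]
    exact (ih fun p hp => hl p (List.mem_cons_of_mem _ hp)).orbitFun_mul
      (hl p List.mem_cons_self) _ _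

theorem isPoly_orbitProd : IsPoly (orbitProd A D d (lowerList n ++ upperList n)) := by
  rw [orbitProd_append]
  refine IsPoly.orbitProd_mul A D ?_ fun p hp => mem_lowerList.mp hp
  rw [← one_mul (orbitProd A D d (upperList n))]
  exact isPoly_one.mul_orbitProd A D fun p hp => mem_upperList.mp hp

theorem coe_prod_e : (((((lowerList n).map fun p => e n d (elemMatrix A (D p) p)).prod *
    ((upperList n).map fun p => e n d (elemMatrix A (D p) p)).prod : schurAlgebra n d)) :
      ConvFamily n d) = orbitProd A D d (lowerList n ++ upperList n) := by
  have h : ∀ l : List (OffDiag n), (((l.map fun p => e n d (elemMatrix A (D p) p)).prod :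
      schurAlgebra n d) : ConvFamily n d) = orbitProd A D d l := by
    intro l
    rw [orbitProd, ← Subalgebra.coe_val, map_list_prod, List.map_map]
    rfl
  rw [orbitProd_append, ← h, ← h]
  rfl

end Products

/-! ### Specialization of v -/

section Specialization

theorem OddField.sqrtQ_sq (κ : OddField) : ((κ.sqrtQ : ℝ)) ^ 2 = κ.q := by
  rw [OddField.sqrtQ, Units.val_mk0, Real.sq_sqrt (by positivity), OddField.q, Nat.cast_pow]

/-- The Laurent polynomial `f(v²)`. -/
def evalSq (f : Polynomial ℤ) : LaurentA :=
  Polynomial.eval₂ LaurentPolynomial.C (LaurentPolynomial.T 2) f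

theorem OddField.spec_evalSq (κ : OddField) (f : Polynomial ℤ) :
    κ.spec (evalSq f) = ((f.eval (κ.q : ℤ) : ℤ) : ℝ) := by
  have h : κ.spec (LaurentPolynomial.T 2) = κ.q := by
    rw [← κ.sqrtQ_sq]
    exact LaurentPolynomial.eval₂_T_n _ _ 2
  rw [evalSq, Polynomial.hom_eval₂, h,
    RingHom.ext_int (κ.spec.comp LaurentPolynomial.C) (Int.castRingHom ℝ)]
  exact Polynomial.eval₂_hom (Int.castRingHom ℝ) (κ.q : ℤ)

/-- After multiplication by a power of $v$, a counterexample would be a nonzero polynomial vanishing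
at $\sqrt p$ for all odd primes $p$. -/
theorem exists_spec_ne_zero {χ : LaurentA} (hχ : χ ≠ 0) : ∃ κ : OddField, κ.spec χ ≠ 0 := by
  by_contra! h
  obtain ⟨m, f, hf⟩ := LaurentPolynomial.exists_T_pow χ
  have hf0 : f ≠ 0 := by
    rintro rfl
    rw [map_zero, eq_comm] at hf
    exact hχ ((LaurentPolynomial.isUnit_T _).mul_left_eq_zero.mp hf)
  have hmap : f.map (Int.castRingHom ℝ) = 0 := by
    refine Polynomial.eq_of_infinite_eval_eq _ _
      ((infinite_odd_primes.image (f := fun p : ℕ => Real.sqrt p) ?_).mono ?_)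
    · intro p _ p' _ hpp'
      have := (Real.sqrt_inj (Nat.cast_nonneg p) (Nat.cast_nonneg p')).mp hpp'
      exact_mod_cast this
    · rintro _ ⟨p, ⟨hp, hodd⟩, rfl⟩
      change Polynomial.eval _ _ = Polynomial.eval _ _
      have h1 := congrArg (OddField.ofPrime p hp hodd).spec hf
      rw [map_mul, h, zero_mul, OddField.spec, LaurentPolynomial.eval₂_toLaurent] at h1
      rw [Polynomial.eval_zero, Polynomial.eval_map, ← h1]
      simp [OddField.sqrtQ, OddField.ofPrime]
  exact hf0 ((Polynomial.map_eq_zero_iff Int.cast_injective).mp hmap)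

theorem ConvFamily.smul_apply (a : LaurentA) (F : ConvFamily n d) (κ : OddField)
    (V V' : Flag κ.K n d) : (a • F) κ V V' = κ.spec a * F κ V V' := by
  change (Matrix.scalar (Flag κ.K n d) (κ.spec a) * F κ) V V' = _
  simp

/-- The value at a pair of flags. -/
def evalAt (κ : OddField) (V V' : Flag κ.K n d) : ConvFamily n d →+ ℝ where
  toFun F := F κ V V'
  map_zero' := rfl
  map_add' _ _ := rfl

theorem finite_Theta : (Theta n d).Finite := by
  refine (Set.Finite.pi' (t := fun _ : Fin n => {f : Fin n → ℕ | ∀ j, f j ∈ Set.Iic d})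
    fun _ => Set.Finite.pi' fun _ => Set.finite_Iic d).subset ?_
  intro C hC i j
  calc C i j ≤ ∑ j, C i j := Finset.single_le_sum (fun _ _ => Nat.zero_le _) (Finset.mem_univ j)
    _ ≤ ∑ i, ∑ j, C i j :=
      Finset.single_le_sum (f := fun i => ∑ j, C i j) (fun _ _ => Nat.zero_le _) (Finset.mem_univ i)
    _ = d := hC

theorem apply_eq_zero_of_mem_span {A : Matrix (Fin n) (Fin n) ℕ} {L : schurAlgebra n d}
    (hL : L ∈ Submodule.span LaurentA (e n d '' {C | C ∈ Theta n d ∧ Prec C A}))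
    (κ : OddField) {V V' : Flag κ.K n d} (hV : relPos V V' = A) :
    (L : ConvFamily n d) κ V V' = 0 := by
  classical
  induction hL using Submodule.span_induction with
  | mem x hx =>
    obtain ⟨C, ⟨-, hC⟩, rfl⟩ := hx
    change orbitFun n d C κ V V' = 0
    rw [orbitFun_apply, if_neg]
    rintro rfl
    rw [hV] at hC
    exact hC.2 hC.1
  | zero => rfl
  | add x y _ _ hx hy =>
    change (x : ConvFamily n d) κ V V' + (y : ConvFamily n d) κ V V' = 0
    rw [hx, hy, add_zero]
  | smul a x _ hx =>
    change (a • (x : ConvFamily n d)) κ V V' = 0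
    rw [ConvFamily.smul_apply, hx, mul_zero]

end Specialization

/-! ### Assembly -/

section Main

variable {A : Matrix (Fin n) (Fin n) ℕ} {D : OffDiag n → Fin n → ℕ}

/-- Two pairs joined by chains of the same type have first flags of the same dimensions. -/
theorem finrank_eq_of_isChain {K : Type} [Field K] {V V' U U' : Flag K n d}
    (h : IsChain A D (lowerList n ++ upperList n) V V')
    (h' : IsChain A D (lowerList n ++ upperList n) U U') (k : Fin (n + 1)) :
    finrank K (V.space k) = finrank K (U.space k) := by
  cases hl : lowerList n ++ upperList n with
  -- The list is empty only for $n\le 1$, where every flag is trivial.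
  | nil =>
    obtain rfl | ⟨i, rfl⟩ := Fin.eq_zero_or_eq_succ k
    · rw [V.first, U.first]
    · by_cases hi : i.succ = Fin.last n
      · rw [hi, V.last, U.last]
      · have hlt : (i : ℕ) + 1 < n := by
          have := Fin.val_lt_last hi
          simpa using this
        have hmem := mem_lowerList_append_upperList
          (⟨(i, ⟨i + 1, hlt⟩), fun hh => by simp [Fin.ext_iff] at hh⟩ : OffDiag n)
        rw [hl] at hmem
        simp at hmem
  | cons p l =>
    rw [hl] at h h'
    obtain ⟨W, h1, -⟩ := h
    obtain ⟨W', h1', -⟩ := h'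
    rw [finrank_left V W, finrank_left U W', h1, h1']

theorem exists_isChain (hA : A ∈ Theta n d) :
    ∃ D : OffDiag n → Fin n → ℕ, (∀ p, elemMatrix A (D p) p ∈ Theta n d) ∧
      ∀ (K : Type) [Field K], ∃ V V' : Flag K n d, relPos V V' = A ∧
        IsChain A D (lowerList n ++ upperList n) V V' := by
  obtain ⟨D, hD1, hD2⟩ := exists_isChain_label hA lowerList_append_upperList_nodup ∅ (by simp)
  refine ⟨D, fun p => hD1 p (mem_lowerList_append_upperList p), fun K _ => ?_⟩
  obtain ⟨b, hb⟩ := exists_relPos_eq K hA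
  refine ⟨_, _, hb, ?_⟩
  have h1 : (label ∅ : Cells A → Fin n) = fun x => x.1.1 := by
    ext x
    simp [label]
  have h2 : (label (∅ ∪ {x | ∃ p ∈ lowerList n ++ upperList n, p.1 = x}) : Cells A → Fin n) =
      fun x => x.1.2 := by
    funext x
    -- Diagonal units are never moved, but their row and column labels agree.
    by_cases hx : x.1.1 = x.1.2
    · simp only [label, hx, ite_self]
    · exact if_pos (Or.inr ⟨⟨x.1, hx⟩, mem_lowerList_append_upperList _, rfl⟩)
  have h3 := hD2 K b
  rwa [h1, h2] at h3

end Main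

end BLM

end

theorem mainTheorem4 (n d : ℕ) (hn : 0 < n) (hd : 0 < d)
    (A : Matrix (Fin n) (Fin n) ℕ) (hA : A ∈ BLM.Theta n d) :
    ∃! D : BLM.OffDiag n → Fin n → ℕ,
      (∀ p, BLM.elemMatrix A (D p) p ∈ BLM.Theta n d) ∧
      ∃ χ : BLM.LaurentA, χ ≠ 0 ∧
        ∃ L ∈ Submodule.span BLM.LaurentA
            (BLM.e n d '' {C | C ∈ BLM.Theta n d ∧ BLM.Prec C A}),
          ((BLM.lowerList n).map fun p => BLM.e n d (BLM.elemMatrix A (D p) p)).prod *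
            ((BLM.upperList n).map fun p => BLM.e n d (BLM.elemMatrix A (D p) p)).prod =
          χ • BLM.e n d A + L := by
  classical
  obtain ⟨D, hD, hchain⟩ := BLM.exists_isChain hA
  refine ⟨D, ⟨hD, ?_⟩, ?_⟩
  · obtain ⟨c, hc⟩ := BLM.isPoly_orbitProd (d := d) A D
    have hfin : {C | C ∈ BLM.Theta n d ∧ BLM.Prec C A}.Finite :=
      BLM.finite_Theta.subset fun C hC => hC.1
    -- The coefficients are the counting polynomials at $q=v^2$.
    refine ⟨BLM.evalSq (c A), fun h0 => ?_, ∑ C ∈ hfin.toFinset, BLM.evalSq (c C) • BLM.e n d C,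
      Submodule.sum_mem _ fun C hC => Submodule.smul_mem _ _ (Submodule.subset_span
        ⟨C, hfin.mem_toFinset.mp hC, rfl⟩), Subtype.ext (BLM.ConvFamily.ext fun κ V V' => ?_)⟩
    · let κ := BLM.OddField.ofPrime 3 Nat.prime_three (by decide)
      obtain ⟨V, V', hV, hVc⟩ := hchain κ.K
      have h1 := (BLM.orbitProd_ne_zero_iff A D).mpr hVc
      rw [hc, hV, ← BLM.OddField.spec_evalSq, h0, map_zero] at h1
      exact h1 rfl
    · rw [BLM.coe_prod_e]
      have hval : ∀ C, ((BLM.evalSq (c C) • BLM.e n d C : BLM.schurAlgebra n d) :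
          BLM.ConvFamily n d) κ V V' = if BLM.relPos V V' = C then
            BLM.orbitProd A D d (BLM.lowerList n ++ BLM.upperList n) κ V V' else 0 := by
        intro C
        change (BLM.evalSq (c C) • BLM.orbitFun n d C) κ V V' = _
        rw [BLM.ConvFamily.smul_apply, BLM.orbitFun_apply, BLM.OddField.spec_evalSq, hc]
        split_ifs with h
        · rw [h, mul_one]
        · rw [mul_zero]
      have hsum : ((BLM.evalSq (c A) • BLM.e n d A +
          ∑ C ∈ hfin.toFinset, BLM.evalSq (c C) • BLM.e n d C : BLM.schurAlgebra n d) :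
            BLM.ConvFamily n d) κ V V' =
          ((BLM.evalSq (c A) • BLM.e n d A : BLM.schurAlgebra n d) :
            BLM.ConvFamily n d) κ V V' + ∑ C ∈ hfin.toFinset,
              ((BLM.evalSq (c C) • BLM.e n d C : BLM.schurAlgebra n d) :
                BLM.ConvFamily n d) κ V V' := by
        have := map_sum ((BLM.evalAt κ V V').comp
          (BLM.schurAlgebra n d).val.toLinearMap.toAddMonoidHom)
          (fun C => BLM.evalSq (c C) • BLM.e n d C) hfin.toFinset
        exact congrArg (_ + ·) this
      rw [hsum, hval, Finset.sum_congr rfl fun C _ => hval C, Finset.sum_ite_eq]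
      by_cases hz : BLM.orbitProd A D d (BLM.lowerList n ++ BLM.upperList n) κ V V' = 0
      · simp [hz]
      · have hVc := (BLM.orbitProd_ne_zero_iff A D).mp hz
        have hpre : BLM.Preceq (BLM.relPos V V') A :=
          BLM.preceq_of_isChain (fun p hp => BLM.mem_lowerList.mp hp)
            (fun p hp => BLM.mem_upperList.mp hp) BLM.lowerList_sorted BLM.upperList_sorted
            BLM.lowerList_nodup BLM.upperList_nodup hVc
        by_cases hVA : BLM.relPos V V' = A
        · rw [if_pos hVA, if_neg fun h => ?_, add_zero]
          have h2 := (hfin.mem_toFinset.mp h).2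
          rw [hVA] at h2
          exact h2.2 h2.1
        · rw [if_neg hVA, if_pos (hfin.mem_toFinset.mpr
            ⟨BLM.relPos_mem_Theta V V', hpre, fun hpre' => hVA ?_⟩), zero_add]
          -- A chain of the same type joins a pair in position $A$, so the row sums agree and
          -- equivalence under $\preceq$ would force equality.
          obtain ⟨U, U', hU, hUc⟩ := hchain κ.K
          refine BLM.eq_of_preceq_preceq hpre hpre' fun k => ?_
          rw [← BLM.finrank_left, ← hU, ← BLM.finrank_left]
          exact BLM.finrank_eq_of_isChain hVc hUc k
  · rintro D' ⟨-, χ, hχ, L, hL, heq⟩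
    obtain ⟨κ, hκ⟩ := BLM.exists_spec_ne_zero hχ
    obtain ⟨V, V', hV, hVc⟩ := hchain κ.K
    -- The lower terms vanish on the orbit of $A$, so the product for `D'` takes the nonzero value
    -- $\chi(\sqrt q)$ at $(V,V')$. Both families thus have chains starting at the same flag.
    have hVc' : BLM.IsChain A D' (BLM.lowerList n ++ BLM.upperList n) V V' := by
      rw [← BLM.orbitProd_ne_zero_iff, ← BLM.coe_prod_e, heq]
      change (χ • BLM.orbitFun n d A) κ V V' + (L : BLM.ConvFamily n d) κ V V' ≠ 0
      rw [BLM.apply_eq_zero_of_mem_span hL κ hV, BLM.ConvFamily.smul_apply, BLM.orbitFun_apply,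
        if_pos hV, add_zero, mul_one]
      exact hκ
    funext p
    exact hVc'.eq_of_finrank_eq hVc (fun _ => rfl) p (BLM.mem_lowerList_append_upperList p)
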